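/- Let $L<R$ be integers, $M\ge 1$, $d\in\mathbb Z$, and for a function $f$ on the unit circle let $\hat f(k)=\frac1{2\pi i}\int_{\gamma_1}z^{-k}f(z)\frac{dz}{z}$, where $\gamma_\rho$ is the positively oriented circle of radius $\rho$ around $0$. Let $\epsilon>0$ and let $\phi_r$, $L\le r<R$, be complex functions on the unit circle with Wiener–Hopf factorizations $\phi_r=\phi_r^+\phi_r^-$ there, where $\phi_r^+$ is analytic and non-zero in $|z|<1+\epsilon$, $\phi_r^-$ is analytic and non-zero in $|z|>1-\epsilon$ including at infinity, and $\phi_r^+(0)=\phi_r^-(\infty)=1$. Put $\phi_{r,s}=\prod_{q=r}^{s-1}\phi_q$ and $\phi^\pm_{r,s}=\prod_{q=r}^{s-1}\phi^\pm_q$ (equal to $1$ if $r\ge s$), and $T_M(f)=(\hat f(j-k))_{1\le j,k\le M}$. Let $x^L_j=x^R_j=d-j$, $1\le j\le M$, and give $\mathbf x=(x^{L+1},\dots,x^{R-1})\in(\mathbb Z^M)^{R-L-1}$ the weight $$q_{L,R,M}(\mathbf x)=\frac{1}{(M!)^{R-L-1}Z_{L,R,M}}\prod_{r=L}^{R-1}\det\big(\hat\phi_r(x^{r+1}_k-x^r_j)\big)_{1\le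 j,k\le M}.$$ Assume that the product of determinants is $\ge 0$ for every $\mathbf x$ and that the partition function $Z_{L,R,M}$, i.e. the sum over $\mathbf x$ of the products of determinants divided by $(M!)^{R-L-1}$, is $>0$. Choose radii with $$\max(0,1-\epsilon)<\rho_3<\rho_1<\sigma_1<\sigma_2<\rho_2<1+\epsilon ,$$ and define $$M_{L,R}(r,u;s,v)=\frac1{(2\pi i)^2}\int_{\gamma_{\rho_1}}dz\int_{\gamma_{\rho_2}}dw\,\frac{z^{u-d}}{w^{v-d+1}(w-z)}\,\frac{\phi^-_{r,R}(z)\phi^+_{L,s}(w)}{\phi^+_{L,r}(z)\phi^-_{s,R}(w)},$$ $$M^*_{L,R}(r,u;s,v)=\frac1{(2\pi i)^2}\int_{\gamma_{\rho_1}}dz\int_{\gamma_{\rho_3}}dw\,\frac{z^{u-d}}{w^{v-d+1}(z-w)}\,\frac{\phi^-_{r,R}(z)\phi^+_{L,s}(w)}{\phi^+_{L,r}(z)\phi^-_{s,R}(w)},$$ $$\mathcal K_0(j,k)=\frac1{(2\pi i)^2}\int_{\gamma_{\sigma_1}}d\omega\int_{\gamma_{\sigma_2}}d\zeta\,\frac{\omega^k}{\zeta^{j+1}(\zeta-\omega)}\,\frac{\phi^+_{L,R}(\omega)\phi^-_{L,R}(\zeta)}{\phi^-_{L,R}(\omega)\phi^+_{L,R}(\zeta)},$$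 $$a_{s,v}(j)=\frac1{(2\pi i)^2}\int_{\gamma_{\rho_2}}dw\int_{\gamma_{\sigma_2}}d\zeta\,\frac{w^{d-v-1}}{\zeta^{j+1}(\zeta-w)}\,\frac{\phi^+_{L,s}(w)\phi^-_{L,R}(\zeta)}{\phi^-_{s,R}(w)\phi^+_{L,R}(\zeta)},$$ $$b_{r,u}(k)=\frac1{(2\pi i)^2}\int_{\gamma_{\rho_1}}dz\int_{\gamma_{\sigma_1}}d\omega\,\frac{\omega^k}{z^{d-u}(\omega-z)}\,\frac{\phi^-_{r,R}(z)\phi^+_{L,R}(\omega)}{\phi^+_{L,r}(z)\phi^-_{L,R}(\omega)}.$$ Then $q_{L,R,M}$ is a probability distribution, and the point process on $\{L+1,\dots,R-1\}\times\mathbb Z$ with particles at the points $(r,x^r_j)$ is determinantal (with respect to counting measure) with correlation kernel $$K_{L,R,M}(r,u;s,v)=-\mathbb I_{r<s}\hat\phi_{r,s}(v-u)+\sum_{i,j=1}^M\hat\phi_{r,R}(d-j-u)\,\big(T_M(\phi_{L,R})^{-1}\big)_{ji}\,\hat\phi_{L,s}(v+i-d),$$ while the dual process, with one particle at each site that is not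 occupied by a particle, is determinantal with kernel $K^*_{L,R,M}(r,u;s,v)=\delta_{r,s}\delta_{u,v}-K_{L,R,M}(r,u;s,v)$. Moreover $\mathcal K_0$ defines a bounded operator on $\ell^2(\{M,M+1,\dots\})$ such that $I-\mathcal K_0$ has a bounded inverse $(I-\mathcal K_0)^{-1}_M$ on this space, $a_{s,v}$ lies in this space, the sums over $k$ below converge, and for all $L<r,s<R$ and $u,v\in\mathbb Z$, $$K_{L,R,M}(r,u;s,v)=-\frac{\mathbb I_{r<s}}{2\pi i}\int_{\gamma_1}z^{u-v}\phi_{r,s}(z)\frac{dz}z+M_{L,R}(r,u;s,v)+\sum_{k=M}^\infty\big((I-\mathcal K_0)^{-1}_Ma_{s,v}\big)(k)\,b_{r,u}(k),$$ $$K^*_{L,R,M}(r,u;s,v)=-\frac{\mathbb I_{s<r}}{2\pi i}\int_{\gamma_1}\frac{z^{u-v}}{\phi_{s,r}(z)}\frac{dz}z+M^*_{L,R}(r,u;s,v)-\sum_{k=M}^\infty\big((I-\mathcal K_0)^{-1}_Ma_{s,v}\big)(k)\,b_{r,u}(k).$$ -/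

import Mathlib

open scoped ComplexOrder

noncomputable section

namespace ToeplitzPaths

/-! ### Symbols -/

/-- A Wiener-Hopf factorization `f = fp * fm` on the unit circle: `fp` is analytic and non-zero in
`‖z‖ < 1 + ε`, `fm` is analytic and non-zero in `‖z‖ > 1 - ε` including at infinity, and the
factors are normalized by `fp 0 = fm ∞ = 1`. Analyticity of `fm` at infinity with value `1` there
is expressed by the limit of `fm` at infinity being `1` (removable singularity). -/
structure WienerHopf (ε : ℝ) (f fp fm : ℂ → ℂ) : Prop where
  factor : ∀ z : ℂ, ‖z‖ = 1 → f z = fp z * fm z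
  analytic_plus : AnalyticOnNhd ℂ fp {z | ‖z‖ < 1 + ε}
  ne_zero_plus : ∀ z : ℂ, ‖z‖ < 1 + ε → fp z ≠ 0
  plus_zero : fp 0 = 1
  analytic_minus : AnalyticOnNhd ℂ fm {z | 1 - ε < ‖z‖}
  ne_zero_minus : ∀ z : ℂ, 1 - ε < ‖z‖ → fm z ≠ 0
  minus_infty : Filter.Tendsto fm (Bornology.cobounded ℂ) (nhds 1)

/-- The `k`-th Fourier coefficient of a function on the unit circle. -/
def fourier (f : ℂ → ℂ) (k : ℤ) : ℂ :=
  (2 * Real.pi * Complex.I)⁻¹ * ∮ z in C(0, 1), z ^ (-k) * f z / z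

/-- `φ_{r,s} = φ_r φ_{r+1} ⋯ φ_{s-1}` (equal to `1` for `r ≥ s`); the same product is used for the
Wiener-Hopf factors `φ_{r,s}^±`. -/
def chain (φ : ℤ → ℂ → ℂ) (r s : ℤ) (z : ℂ) : ℂ := ∏ q ∈ Finset.Ico r s, φ q z

/-! ### The measure given by a product of determinants -/

/-- The space `{L+1, …, R-1} × ℤ` on which the particles live. -/
abbrev Site (L R : ℤ) : Type := Set.Ioo L R × ℤ

/-- Positions `x_j^r` of the `M` particles at the levels `L < r < R`. -/
abbrev Config (L R : ℤ) (M : ℕ) : Type := Set.Ioo L R → Fin M → ℤ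

/-- All the positions, including the fixed ones `d - 1, …, d - M` at the levels `L` and `R`
(`j : Fin M` is counted from zero). -/
def position {L R : ℤ} {M : ℕ} (d : ℤ) (x : Config L R M) (r : ℤ) (j : Fin M) : ℤ :=
  if h : r ∈ Set.Ioo L R then x ⟨r, h⟩ j else d - ((j : ℤ) + 1)

/-- The unnormalized weight: the product over `L ≤ r < R` of
`det (p_{r,r+1}(x_j^r, x_k^{r+1}))`, with `p_{r,r+1}(x, y)` the Fourier coefficient of `φ_r`
at `y - x`. -/
def weight {L R : ℤ} {M : ℕ} (d : ℤ) (φ : ℤ → ℂ → ℂ) (x : Config L R M) : ℂ :=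
  ∏ r ∈ Finset.Ico L R, Matrix.det (Matrix.of fun j k : Fin M =>
    fourier (φ r) (position d x (r + 1) k - position d x r j))

/-- The partition function `Z_{L,R,M}`. -/
def partitionFunction (L R : ℤ) (M : ℕ) (d : ℤ) (φ : ℤ → ℂ → ℂ) : ℂ :=
  (∑' x : Config L R M, weight d φ x) / (M.factorial : ℂ) ^ (R - L - 1).toNat

/-- The density `q_{L,R,M}` with respect to counting measure. -/
def density {L R : ℤ} {M : ℕ} (d : ℤ) (φ : ℤ → ℂ → ℂ) (x : Config L R M) : ℂ :=
  weight d φ x / ((M.factorial : ℂ) ^ (R - L - 1).toNat * partitionFunction L R M d φ)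

/-- The measure with density `q_{L,R,M}`. -/
def pathMeasure (L R : ℤ) (M : ℕ) (d : ℤ) (φ : ℤ → ℂ → ℂ) :
    MeasureTheory.Measure (Config L R M) :=
  MeasureTheory.Measure.count.withDensity fun x => ENNReal.ofReal (density d φ x).re

/-! ### Point processes on a discrete space -/

/-- The number of particles of `x` at each site. -/
def particles {L R : ℤ} {M : ℕ} (x : Config L R M) (p : Site L R) : ℕ :=
  (Finset.univ.filter fun j : Fin M => x p.1 j = p.2).card

/-- The dual system: one particle at each site that is not occupied by a particle of `x`. -/
def holes {L R : ℤ} {M : ℕ} (x : Config L R M) (p : Site L R) : ℕ :=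
  if particles x p = 0 then 1 else 0

/-- The point process that has `ξ ω p` particles at `p`, where `ω` is distributed according to
`P`, is determinantal with kernel `K`, with respect to counting measure on the discrete space `S`:
its correlation functions exist and are `ρ_n(x_1, …, x_n) = det (K(x_i, x_j))`, that is,
`E[∏ (1 - f(x_i))] = ∑_n (-1)^n / n! ∑_{x ∈ S^n} ∏_j f(x_j) ρ_n(x)` for all `f` of bounded
(here: finite) support. Since `f` vanishes off its support, both the product over the particles
and the sum over `S^n` are written with points of the support only. -/
def IsDeterminantal {Ω S : Type*} [MeasurableSpace Ω] (P : MeasureTheory.Measure Ω)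
    (ξ : Ω → S → ℕ) (K : S → S → ℂ) : Prop :=
  ∀ f : S →₀ ℂ,
    MeasureTheory.Integrable (fun ω => ∏ p ∈ f.support, (1 - f p) ^ ξ ω p) P ∧
    HasSum (fun n : ℕ => (-1 : ℂ) ^ n / (n.factorial : ℂ) *
        ∑ x ∈ Fintype.piFinset (fun _ : Fin n => f.support),
          (∏ j, f (x j)) * Matrix.det (Matrix.of fun i j => K (x i) (x j)))
      (∫ ω, ∏ p ∈ f.support, (1 - f p) ^ ξ ω p ∂P)

/-! ### The kernels -/

/-- The Toeplitz matrix `T_M(f)`. -/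
def toeplitz (M : ℕ) (f : ℂ → ℂ) : Matrix (Fin M) (Fin M) ℂ :=
  Matrix.of fun j k => fourier f ((j : ℤ) - (k : ℤ))

/-- `p_{r,s}(x, y)`, which is zero for `r ≥ s`. -/
def transition (φ : ℤ → ℂ → ℂ) (r s x y : ℤ) : ℂ :=
  if r < s then fourier (chain φ r s) (y - x) else 0

/-- The kernel `K_{L,R,M}(r,u;s,v)` of the process with `M` paths, as defined by the inverse of
the finite Toeplitz matrix `T_M(φ_{L,R})`. -/
def pathKernel (L R : ℤ) (M : ℕ) (d : ℤ) (φ : ℤ → ℂ → ℂ) (r u s v : ℤ) : ℂ :=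
  - transition φ r s u v +
    ∑ i : Fin M, ∑ j : Fin M,
      fourier (chain φ r R) (d - ((j : ℤ) + 1) - u) * (toeplitz M (chain φ L R))⁻¹ j i *
        fourier (chain φ L s) (v + ((i : ℤ) + 1) - d)

/-- The kernel `δ_{r,s} δ_{u,v} - K_{L,R,M}(r,u;s,v)` of the dual process. -/
def dualPathKernel (L R : ℤ) (M : ℕ) (d : ℤ) (φ : ℤ → ℂ → ℂ) (r u s v : ℤ) : ℂ :=
  (if r = s ∧ u = v then 1 else 0) - pathKernel L R M d φ r u s v

/-- `M_{L,R}(r,u;s,v)`. -/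
def mainKernel (L R d : ℤ) (φp φm : ℤ → ℂ → ℂ) (ρ₁ ρ₂ : ℝ) (r u s v : ℤ) : ℂ :=
  ((2 * Real.pi * Complex.I) ^ 2)⁻¹ * ∮ z in C(0, ρ₁), ∮ w in C(0, ρ₂),
    z ^ (u - d) / (w ^ (v - d + 1) * (w - z)) *
      ((chain φm r R z * chain φp L s w) / (chain φp L r z * chain φm s R w))

/-- `M*_{L,R}(r,u;s,v)`. -/
def mainKernelStar (L R d : ℤ) (φp φm : ℤ → ℂ → ℂ) (ρ₁ ρ₃ : ℝ) (r u s v : ℤ) : ℂ :=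
  ((2 * Real.pi * Complex.I) ^ 2)⁻¹ * ∮ z in C(0, ρ₁), ∮ w in C(0, ρ₃),
    z ^ (u - d) / (w ^ (v - d + 1) * (z - w)) *
      ((chain φm r R z * chain φp L s w) / (chain φp L r z * chain φm s R w))

/-- `𝒦₀(j,k)`. -/
def kernelZero (L R : ℤ) (φp φm : ℤ → ℂ → ℂ) (σ₁ σ₂ : ℝ) (j k : ℕ) : ℂ :=
  ((2 * Real.pi * Complex.I) ^ 2)⁻¹ * ∮ ω in C(0, σ₁), ∮ ζ in C(0, σ₂),
    ω ^ k / (ζ ^ (j + 1) * (ζ - ω)) *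
      ((chain φp L R ω * chain φm L R ζ) / (chain φm L R ω * chain φp L R ζ))

/-- `a_{s,v}(j)`. -/
def aCoeff (L R d : ℤ) (φp φm : ℤ → ℂ → ℂ) (ρ₂ σ₂ : ℝ) (s v : ℤ) (j : ℕ) : ℂ :=
  ((2 * Real.pi * Complex.I) ^ 2)⁻¹ * ∮ w in C(0, ρ₂), ∮ ζ in C(0, σ₂),
    w ^ (d - v - 1) / (ζ ^ (j + 1) * (ζ - w)) *
      ((chain φp L s w * chain φm L R ζ) / (chain φm s R w * chain φp L R ζ))

/-- `b_{r,u}(k)`. -/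
def bCoeff (L R d : ℤ) (φp φm : ℤ → ℂ → ℂ) (ρ₁ σ₁ : ℝ) (r u : ℤ) (k : ℕ) : ℂ :=
  ((2 * Real.pi * Complex.I) ^ 2)⁻¹ * ∮ z in C(0, ρ₁), ∮ ω in C(0, σ₁),
    ω ^ k / (z ^ (d - u) * (ω - z)) *
      ((chain φm r R z * chain φp L R ω) / (chain φp L r z * chain φm L R ω))

/-! ### Operators on the space of square summable sequences -/

/-- `ℓ²({M, M+1, …})`. -/
abbrev TailSpace (M : ℕ) : Type := lp (fun _ : Set.Ici M => ℂ) 2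

/-- The bounded operator `T` on `ℓ²({M, M+1, …})` has the matrix `(A(j,k))_{j,k ≥ M}`; it is
determined by this matrix. -/
def HasMatrix {M : ℕ} (T : TailSpace M →L[ℂ] TailSpace M) (A : ℕ → ℕ → ℂ) : Prop :=
  ∀ (g : TailSpace M) (j : Set.Ici M), HasSum (fun k : Set.Ici M => A j k * g k) (T g j)

end ToeplitzPaths

end

/-!
The proof has a probabilistic and an analytic part. They meet in the Toeplitz matrix
`T_M(φ_{L,R})`, whose determinant is the partition function and hence is not zero.

*Determinantal structure.* To compute `E[∏ (1 - f(x))]`, sum the product of determinants over the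
configurations, level by level. Each level is one use of Andréief's identity
(`hasSum_det_mul_det`), and the result is the `M × M` determinant of the transfer matrix with the
factors `1 - f` inserted (`tsum_det_mul_prod`). Because Fourier coefficients of products are
convolutions (`hasSum_fourier_mul`), this matrix is `T_M(φ_{L,R}) - g F Φ`, where `F` is the
diagonal matrix of `f` on its finite support, and `g (1 + F W) = Ψ` sums over the visits to that
support (`hasSum_propagated`). Here `W`, `Ψ`, `Φ` hold the transition coefficients between sites,
from the level `L`, and to the level `R`. As `W` is strictly triangular with respect to the levels,
`det (1 + W F) = 1`, and Sylvester's identity turns the quotient of determinants into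
`det (1 - K F)` over the support of `f` (`det_sub_eq_det_mul_det`). Its Fredholm expansion
(`hasSum_fredholm`) is the definition of a determinantal process. For the holes, almost surely no
site carries two particles, so that exchanging particles and holes replaces `1 - f` by its inverse;
the values `f = 1` are reached by continuity.

*The contour integral formulas.* Expanding `1 / (w - z)` in a geometric series turns each double
contour integral into a matrix entry of a product of two Toeplitz operators on `ℓ²(ℕ)`
(`hasSum_doubleIntegral_inner_large`, `hasSum_doubleIntegral_inner_small`). Write
`U = T(φ⁻_{L,R})` and `D = T(φ⁺_{L,R})`. Then `I - 𝒦₀ = U D⁻¹ U⁻¹ D` by Widom's identity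
`T(FG) = T(F) T(G) + H(F) H(G~)` (`fourier_mul_eq_add`), and the triangular shape of `U` and `D`
shows that the compression of this operator to `ℓ²({M, M+1, …})` is inverted by the Schur complement
of the leading block `T_M(φ_{L,R})` of `U D` (`isUnit_compression_and_inverse`). Inserting this
inverse between the row and the column that belong to two sites gives the formula for the kernel
(`borodin_okounkov`, `exists_correction`). The formula for the dual kernel follows, since the two
double integrals differ by the residue at `w = z`, which is once more the convolution theorem
(`mainKernel_add_mainKernelStar`).
-/

noncomputable section

namespace ToeplitzPaths

/-! ### Laurent coefficients of functions on an annulus -/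

/-- The open annulus `a < ‖z‖ < b`. -/
def annulus (a b : ℝ) : Set ℂ := {z | a < ‖z‖ ∧ ‖z‖ < b}

theorem isOpen_annulus (a b : ℝ) : IsOpen (annulus a b) :=
  (isOpen_lt continuous_const continuous_norm).inter (isOpen_lt continuous_norm continuous_const)

theorem sphere_subset_annulus {a b ρ : ℝ} (h1 : a < ρ) (h2 : ρ < b) :
    Metric.sphere (0 : ℂ) ρ ⊆ annulus a b := by
  intro z hz
  rw [mem_sphere_zero_iff_norm] at hz
  exact ⟨hz ▸ h1, hz ▸ h2⟩

theorem continuousOn_sphere_zpow {ρ : ℝ} (hρ : 0 < ρ) (n : ℤ) :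
    ContinuousOn (fun z : ℂ => z ^ n) (Metric.sphere 0 ρ) := by
  intro z hz
  rw [mem_sphere_zero_iff_norm] at hz
  exact (continuousAt_zpow₀ z n (Or.inl (norm_pos_iff.1 (hz ▸ hρ)))).continuousWithinAt

/-- Termwise integration of a normally convergent series over a circle. -/
theorem hasSum_circleIntegral {ι : Type*} [Countable ι] {ρ : ℝ} (hρ : 0 ≤ ρ) {G : ι → ℂ → ℂ}
    {g : ℂ → ℂ} {u : ι → ℝ} (hG : ∀ l, ContinuousOn (G l) (Metric.sphere 0 ρ))
    (hb : ∀ l, ∀ z ∈ Metric.sphere (0 : ℂ) ρ, ‖G l z‖ ≤ u l) (hu : Summable u)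
    (hs : ∀ z ∈ Metric.sphere (0 : ℂ) ρ, HasSum (fun l => G l z) (g z)) :
    HasSum (fun l => ∮ z in C(0, ρ), G l z) (∮ z in C(0, ρ), g z) := by
  have hm : ∀ θ, circleMap 0 ρ θ ∈ Metric.sphere (0 : ℂ) ρ := circleMap_mem_sphere 0 hρ
  refine intervalIntegral.hasSum_integral_of_dominated_convergence (fun l _ => ρ * u l) ?_ ?_ ?_ ?_ ?_
  · intro l
    refine Continuous.aestronglyMeasurable ?_
    simp only [deriv_circleMap, smul_eq_mul]
    exact ((continuous_circleMap 0 ρ).mul continuous_const).mul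
      ((hG l).comp_continuous (continuous_circleMap 0 ρ) hm)
  · intro l
    refine Filter.Eventually.of_forall fun θ _ => ?_
    simp only [deriv_circleMap, smul_eq_mul, norm_mul, Complex.norm_I, mul_one]
    rw [mem_sphere_zero_iff_norm.1 (hm θ)]
    exact mul_le_mul_of_nonneg_left (hb l _ (hm θ)) hρ
  · exact Filter.Eventually.of_forall fun θ _ => hu.mul_left ρ
  · exact intervalIntegrable_const
  · exact Filter.Eventually.of_forall fun θ _ => (hs _ (hm θ)).const_smul _

theorem fourier_eq (F : ℂ → ℂ) (n : ℤ) :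
    fourier F (-n - 1) = (2 * Real.pi * Complex.I)⁻¹ * ∮ z in C(0, 1), z ^ n * F z := by
  unfold fourier
  congr 1
  refine circleIntegral.integral_congr zero_le_one fun z hz => ?_
  have hz0 : z ≠ 0 := by
    rintro rfl; simp at hz
  have : z ^ (-(-n - 1)) = z ^ n * z := by
    rw [← zpow_add_one₀ hz0]; congr 1; ring
  simp only [this]
  field_simp

theorem fourier_congr {F G : ℂ → ℂ} (h : ∀ z : ℂ, ‖z‖ = 1 → F z = G z) (k : ℤ) :
    fourier F k = fourier G k := by
  unfold fourier
  congr 1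
  refine circleIntegral.integral_congr zero_le_one fun z hz => ?_
  simp only [h z (mem_sphere_zero_iff_norm.1 hz)]

/-- The coefficients of a function that is analytic on an annulus can be computed on any circle
inside the annulus. -/
theorem circleIntegral_zpow_mul {a b ρ : ℝ} (ha : 0 ≤ a) (ha1 : a < 1) (hb1 : 1 < b)
    (hρ : a < ρ) (hρ' : ρ < b) {F : ℂ → ℂ} (hF : DifferentiableOn ℂ F (annulus a b)) (n : ℤ) :
    ∮ z in C(0, ρ), z ^ n * F z = 2 * Real.pi * Complex.I * fourier F (-n - 1) := by
  rw [fourier_eq, mul_inv_cancel_left₀ Complex.two_pi_I_ne_zero]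
  have key : ∀ r R : ℝ, a < r → r ≤ R → R < b →
      ∮ z in C(0, R), z ^ n * F z = ∮ z in C(0, r), z ^ n * F z := by
    intro r R hr hrR hR
    have hsub : Metric.closedBall (0 : ℂ) R \ Metric.ball 0 r ⊆ annulus a b := by
      intro z hz
      simp only [Set.mem_sdiff, Metric.mem_closedBall, dist_zero_right, Metric.mem_ball, not_lt] at hz
      exact ⟨hr.trans_le hz.2, hz.1.trans_lt hR⟩
    have hd : DifferentiableOn ℂ (fun z => z ^ n * F z) (annulus a b) := by
      refine DifferentiableOn.mul (fun z hz => ?_) hF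
      exact (differentiableAt_zpow.2
        (Or.inl (norm_pos_iff.1 (ha.trans_lt hz.1)))).differentiableWithinAt
    refine Complex.circleIntegral_eq_of_differentiable_on_annulus_off_countable (ha.trans_lt hr) hrR
      Set.countable_empty (hd.continuousOn.mono hsub) fun z hz => ?_
    refine (hd z ?_).differentiableAt ((isOpen_annulus a b).mem_nhds ?_) <;>
    exact hsub ⟨Metric.ball_subset_closedBall hz.1.1,
      fun h => hz.1.2 (Metric.ball_subset_closedBall h)⟩
  rcases le_total ρ 1 with h | h
  · exact (key ρ 1 hρ h hb1).symm
  · exact key 1 ρ ha1 h hρ'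

theorem exists_norm_le_on_sphere {F : ℂ → ℂ} {ρ : ℝ} (h : ContinuousOn F (Metric.sphere 0 ρ)) :
    ∃ C : ℝ, 0 ≤ C ∧ ∀ z ∈ Metric.sphere (0 : ℂ) ρ, ‖F z‖ ≤ C := by
  obtain ⟨C, hC⟩ := (isCompact_sphere (0 : ℂ) ρ).exists_bound_of_continuousOn h
  exact ⟨max C 0, le_max_right _ _, fun z hz => (hC z hz).trans (le_max_left _ _)⟩

theorem norm_fourier_le {a b ρ : ℝ} (ha : 0 ≤ a) (ha1 : a < 1) (hb1 : 1 < b)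
    (hρ : a < ρ) (hρ' : ρ < b) {F : ℂ → ℂ} (hF : DifferentiableOn ℂ F (annulus a b)) {C : ℝ}
    (hC : ∀ z ∈ Metric.sphere (0 : ℂ) ρ, ‖F z‖ ≤ C) (k : ℤ) :
    ‖fourier F k‖ ≤ C * ρ ^ (-k) := by
  have hρ0 : 0 < ρ := ha.trans_lt hρ
  have h := circleIntegral_zpow_mul ha ha1 hb1 hρ hρ' hF (-k - 1)
  have h2 : fourier F k = (2 * Real.pi * Complex.I)⁻¹ • ∮ z in C(0, ρ), z ^ (-k - 1) * F z := by
    rw [h, smul_eq_mul, inv_mul_cancel_left₀ Complex.two_pi_I_ne_zero]; congr 1; ring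
  rw [h2]
  refine (circleIntegral.norm_two_pi_i_inv_smul_integral_le_of_norm_le_const hρ0.le
    (C := ρ ^ (-k - 1) * C) fun z hz => ?_).trans_eq ?_
  · rw [norm_mul, norm_zpow, mem_sphere_zero_iff_norm.1 hz]
    exact mul_le_mul_of_nonneg_left (hC z hz) (zpow_pos hρ0 _).le
  · rw [← mul_assoc, mul_comm ρ, ← zpow_add_one₀ hρ0.ne', mul_comm]; congr 2; ring

theorem summable_fourier {a b : ℝ} (ha : 0 ≤ a) (ha1 : a < 1) (hb1 : 1 < b)
    {F : ℂ → ℂ} (hF : DifferentiableOn ℂ F (annulus a b)) :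
    Summable fun k : ℤ => ‖fourier F k‖ := by
  obtain ⟨r, har, hr1⟩ := exists_between ha1
  obtain ⟨R, h1R, hRb⟩ := exists_between hb1
  have hr0 : 0 < r := ha.trans_lt har
  have hR0 : 0 < R := zero_lt_one.trans h1R
  obtain ⟨C, hC0, hC⟩ := exists_norm_le_on_sphere
    (hF.continuousOn.mono (sphere_subset_annulus (h1R.trans' ha1) hRb))
  obtain ⟨C', hC0', hC'⟩ := exists_norm_le_on_sphere
    (hF.continuousOn.mono (sphere_subset_annulus har (hr1.trans hb1)))
  refine Summable.of_nat_of_neg ?_ ?_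
  · refine Summable.of_nonneg_of_le (fun _ => norm_nonneg _)
      (fun n => norm_fourier_le ha ha1 hb1 (h1R.trans' ha1) hRb hF hC n) ?_
    have : Summable fun n : ℕ => C * (R⁻¹) ^ n :=
      (summable_geometric_of_lt_one (by positivity) (inv_lt_one_of_one_lt₀ h1R)).mul_left C
    refine this.congr fun n => ?_
    rw [zpow_neg, zpow_natCast, inv_pow]
  · refine Summable.of_nonneg_of_le (fun _ => norm_nonneg _)
      (fun n => norm_fourier_le ha ha1 hb1 har (hr1.trans hb1) hF hC' _) ?_
    have : Summable fun n : ℕ => C' * r ^ n := (summable_geometric_of_lt_one hr0.le hr1).mul_left C'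
    refine this.congr fun n => ?_
    rw [neg_neg, zpow_natCast]

/-- The Laurent expansion on the unit circle, obtained as a Fourier series. -/
theorem hasSum_fourier {a b : ℝ} (ha : 0 ≤ a) (ha1 : a < 1) (hb1 : 1 < b)
    {F : ℂ → ℂ} (hF : DifferentiableOn ℂ F (annulus a b)) {z : ℂ} (hz : ‖z‖ = 1) :
    HasSum (fun k : ℤ => fourier F k * z ^ k) (F z) := by
  have : Fact (0 < 2 * Real.pi) := ⟨Real.two_pi_pos⟩
  have hcont : ContinuousOn F (Metric.sphere 0 1) :=
    hF.continuousOn.mono (sphere_subset_annulus ha1 hb1)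
  let f : C(AddCircle (2 * Real.pi), ℂ) :=
    ⟨fun x => F (AddCircle.toCircle x), hcont.comp_continuous
      (continuous_subtype_val.comp (AddCircle.continuous_toCircle)) (fun x => by simp [Circle.norm_coe])⟩
  have hval : ∀ θ : ℝ, ((AddCircle.toCircle (θ : AddCircle (2 * Real.pi)) : Circle) : ℂ) =
      circleMap 0 1 θ := by
    intro θ
    rw [AddCircle.toCircle_apply_mk, Circle.coe_exp, circleMap]
    simp
  have hpow : ∀ (k : ℤ) (θ : ℝ), (_root_.fourier k (θ : AddCircle (2 * Real.pi)) : ℂ) =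
      (circleMap 0 1 θ) ^ k := by
    intro k θ
    rw [_root_.fourier_apply, AddCircle.toCircle_zsmul, Circle.coe_zpow, hval]
  have hcoeff : ∀ k : ℤ, fourierCoeff f k = fourier F k := by
    intro k
    rw [fourierCoeff_eq_intervalIntegral f k 0, zero_add, fourier, circleIntegral,
      mul_inv, mul_assoc, ← intervalIntegral.integral_const_mul, Complex.real_smul]
    push_cast
    rw [one_div]
    congr 1
    refine intervalIntegral.integral_congr fun θ _ => ?_
    have h0 : circleMap 0 1 θ ≠ 0 := circleMap_ne_center one_ne_zero
    change _ • F _ = _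
    rw [hpow, hval]
    simp only [deriv_circleMap, smul_eq_mul]
    field_simp
  have hsum : Summable (fourierCoeff f) := by
    refine Summable.of_norm ?_
    simp only [hcoeff]
    exact summable_fourier ha ha1 hb1 hF
  obtain ⟨θ, -, hθ⟩ : z ∈ circleMap 0 1 '' Set.Ioc 0 (2 * Real.pi) := by
    rw [image_circleMap_Ioc]; simp [hz]
  have := has_pointwise_sum_fourier_series_of_summable hsum (θ : AddCircle (2 * Real.pi))
  simp only [hcoeff, hpow, hθ, smul_eq_mul] at this
  convert this using 1
  change F z = F _
  rw [hval, hθ]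

/-- The coefficients of a product are the convolution of the coefficients. -/
theorem hasSum_fourier_mul {a b : ℝ} (ha : 0 ≤ a) (ha1 : a < 1) (hb1 : 1 < b)
    {F G : ℂ → ℂ} (hF : DifferentiableOn ℂ F (annulus a b))
    (hG : DifferentiableOn ℂ G (annulus a b)) (k : ℤ) :
    HasSum (fun m : ℤ => fourier F (k - m) * fourier G m) (fourier (fun z => F z * G z) k) := by
  have hFc := hF.continuousOn.mono (sphere_subset_annulus ha1 hb1)
  obtain ⟨C, hC0, hC⟩ := exists_norm_le_on_sphere hFc
  have h := hasSum_circleIntegral zero_le_one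
    (G := fun (m : ℤ) z => fourier G m * (z ^ (-(k - m) - 1) * F z))
    (g := fun z => z ^ (-k - 1) * (F z * G z))
    (u := fun m => ‖fourier G m‖ * C) ?_ ?_ ?_ ?_
  · have h2 := h.mul_left (2 * Real.pi * Complex.I)⁻¹
    rw [← fourier_eq] at h2
    have e : -(-k - 1) - 1 = k := by ring
    rw [e] at h2
    refine h2.congr_fun ?_
    intro m
    simp only [circleIntegral.integral_const_mul]
    have := fourier_eq F (-(k - m) - 1)
    rw [show -(-(k - m) - 1) - 1 = k - m by ring] at this
    rw [this]; ring
  · exact fun m => continuousOn_const.mul ((continuousOn_sphere_zpow one_pos _).mul hFc)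
  · intro m z hz
    have hz1 := mem_sphere_zero_iff_norm.1 hz
    rw [norm_mul, norm_mul, norm_zpow, hz1, one_zpow, one_mul]
    exact mul_le_mul_of_nonneg_left (hC z hz) (norm_nonneg _)
  · exact (summable_fourier ha ha1 hb1 hG).mul_right C
  · intro z hz
    have hz1 := mem_sphere_zero_iff_norm.1 hz
    have hz0 : z ≠ 0 := by rintro rfl; simp at hz1
    have := (hasSum_fourier ha ha1 hb1 hG hz1).mul_left (z ^ (-k - 1) * F z)
    rw [mul_assoc] at this
    refine this.congr_fun ?_
    intro m
    rw [show -(k - m) - 1 = (-k - 1) + m by ring, zpow_add₀ hz0]; ring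

/-- A function analytic in a disc has no negative coefficients. -/
theorem fourier_eq_zero_of_neg {b : ℝ} (hb1 : 1 < b) {F : ℂ → ℂ}
    (hF : DifferentiableOn ℂ F (Metric.ball 0 b)) {k : ℤ} (hk : k < 0) : fourier F k = 0 := by
  obtain ⟨n, hn⟩ : ∃ n : ℕ, -k - 1 = n := ⟨(-k - 1).toNat, by omega⟩
  have h := fourier_eq F (n : ℤ)
  rw [← hn, show -(-k - 1) - 1 = k by ring] at h
  rw [h, hn]
  have hd : DifferentiableOn ℂ (fun z => z ^ (n : ℤ) * F z) (Metric.ball 0 b) := by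
    simp only [zpow_natCast]
    exact (differentiable_id.pow n).differentiableOn.mul hF
  rw [Complex.circleIntegral_eq_zero_of_differentiable_on_off_countable zero_le_one
    Set.countable_empty (hd.continuousOn.mono (Metric.closedBall_subset_ball hb1)), mul_zero]
  intro z hz
  have : z ∈ Metric.ball (0 : ℂ) b := Metric.ball_subset_ball hb1.le hz.1
  exact (hd z this).differentiableAt (Metric.isOpen_ball.mem_nhds this)

/-- A function analytic outside a disc and convergent at infinity has no positive coefficients. -/
theorem fourier_eq_zero_of_pos {a : ℝ} (ha : 0 ≤ a) (ha1 : a < 1) {F : ℂ → ℂ}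
    (hF : DifferentiableOn ℂ F {z | a < ‖z‖}) {l : ℂ}
    (hl : Filter.Tendsto F (Bornology.cobounded ℂ) (nhds l)) {k : ℤ} (hk : 0 < k) :
    fourier F k = 0 := by
  have hev : ∀ᶠ z in Bornology.cobounded ℂ, ‖F z‖ ≤ ‖l‖ + 1 :=
    (hl.norm.eventually (gt_mem_nhds (lt_add_one _))).mono fun _ h => h.le
  rw [← comap_norm_atTop] at hev
  obtain ⟨t, ht, hts⟩ := Filter.mem_comap.1 hev
  have hlim : Filter.Tendsto (fun ρ : ℝ => (‖l‖ + 1) * ρ⁻¹) Filter.atTop (nhds 0) := by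
    simpa using tendsto_inv_atTop_zero.const_mul (‖l‖ + 1)
  have hle : ‖fourier F k‖ ≤ 0 := by
    refine ge_of_tendsto hlim ?_
    filter_upwards [ht, Filter.eventually_ge_atTop 1] with ρ hρ h1
    have hC : ∀ z ∈ Metric.sphere (0 : ℂ) ρ, ‖F z‖ ≤ ‖l‖ + 1 := fun z hz =>
      hts (by simpa [mem_sphere_zero_iff_norm.1 hz] using hρ)
    have h := norm_fourier_le (b := ρ + 1) ha ha1 (by linarith) (by linarith) (by linarith)
      (hF.mono fun z hz => hz.1) hC k
    refine h.trans (mul_le_mul_of_nonneg_left ?_ (by positivity))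
    rw [← zpow_neg_one]
    exact zpow_le_zpow_right₀ h1 (by omega)
  exact norm_le_zero_iff.1 hle

/-! ### Double contour integrals as series -/

theorem hasSum_circleIntegral_div_sub_of_lt {ρ : ℝ} {g : ℂ → ℂ}
    (hg : ContinuousOn g (Metric.sphere 0 ρ)) {z : ℂ} (hz : ‖z‖ < ρ) :
    HasSum (fun l : ℕ => z ^ l * ∮ w in C(0, ρ), w ^ (-(l : ℤ) - 1) * g w)
      (∮ w in C(0, ρ), g w / (w - z)) := by
  have hρ0 : 0 < ρ := (norm_nonneg z).trans_lt hz
  obtain ⟨C, hC0, hC⟩ := exists_norm_le_on_sphere hg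
  have h := hasSum_circleIntegral hρ0.le
    (G := fun (l : ℕ) w => z ^ l * (w ^ (-(l : ℤ) - 1) * g w)) (g := fun w => g w / (w - z))
    (u := fun l => (‖z‖ / ρ) ^ l * (ρ⁻¹ * C)) ?_ ?_ ?_ ?_
  · simpa only [circleIntegral.integral_const_mul] using h
  · exact fun l => continuousOn_const.mul ((continuousOn_sphere_zpow hρ0 _).mul hg)
  · intro l w hw
    have hw1 := mem_sphere_zero_iff_norm.1 hw
    rw [norm_mul, norm_mul, norm_zpow, norm_pow, hw1, zpow_sub_one₀ hρ0.ne', zpow_neg,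
      zpow_natCast, div_pow, ← mul_assoc, ← mul_assoc, div_eq_mul_inv]
    refine le_of_le_of_eq (mul_le_mul_of_nonneg_left (hC w hw) (by positivity)) ?_
    ring
  · exact (summable_geometric_of_lt_one (by positivity) ((div_lt_one hρ0).2 hz)).mul_right _
  · intro w hw
    have hw1 := mem_sphere_zero_iff_norm.1 hw
    have hw0 : w ≠ 0 := norm_pos_iff.1 (hw1 ▸ hρ0)
    have hlt : ‖z / w‖ < 1 := by rw [norm_div, hw1]; exact (div_lt_one hρ0).2 hz
    have hne : w - z ≠ 0 := by
      intro h0; rw [sub_eq_zero] at h0; rw [← h0, hw1] at hz; exact lt_irrefl _ hz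
    have h1 := (hasSum_geometric_of_norm_lt_one hlt).mul_right (w⁻¹ * g w)
    have e : (1 - z / w)⁻¹ * (w⁻¹ * g w) = g w / (w - z) := by
      rw [one_sub_div hw0]; field_simp
    rw [e] at h1
    refine h1.congr_fun fun l => ?_
    rw [zpow_sub_one₀ hw0, zpow_neg, zpow_natCast, div_pow]
    ring

theorem hasSum_circleIntegral_div_sub_of_gt {ρ : ℝ} (hρ0 : 0 < ρ) {g : ℂ → ℂ}
    (hg : ContinuousOn g (Metric.sphere 0 ρ)) {w : ℂ} (hw : ρ < ‖w‖) :
    HasSum (fun l : ℕ => w ^ (-(l : ℤ) - 1) * ∮ z in C(0, ρ), z ^ l * g z)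
      (∮ z in C(0, ρ), g z / (w - z)) := by
  have hw1 : 0 < ‖w‖ := hρ0.trans hw
  have hw0 : w ≠ 0 := norm_pos_iff.1 hw1
  obtain ⟨C, hC0, hC⟩ := exists_norm_le_on_sphere hg
  have h := hasSum_circleIntegral hρ0.le
    (G := fun (l : ℕ) z => w ^ (-(l : ℤ) - 1) * (z ^ l * g z)) (g := fun z => g z / (w - z))
    (u := fun l => (ρ / ‖w‖) ^ l * (‖w‖⁻¹ * C)) ?_ ?_ ?_ ?_
  · simpa only [circleIntegral.integral_const_mul] using h
  · exact fun l => continuousOn_const.mul ((continuousOn_id.pow l).mul hg)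
  · intro l z hz
    have hz1 := mem_sphere_zero_iff_norm.1 hz
    rw [norm_mul, norm_mul, norm_zpow, norm_pow, hz1, zpow_sub_one₀ hw1.ne', zpow_neg,
      zpow_natCast, div_pow, ← mul_assoc, ← mul_assoc, div_eq_mul_inv]
    refine le_of_le_of_eq (mul_le_mul_of_nonneg_left (hC z hz) (by positivity)) ?_
    ring
  · exact (summable_geometric_of_lt_one (by positivity) ((div_lt_one hw1).2 hw)).mul_right _
  · intro z hz
    have hz1 := mem_sphere_zero_iff_norm.1 hz
    have hlt : ‖z / w‖ < 1 := by rw [norm_div, hz1]; exact (div_lt_one hw1).2 hw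
    have hne : w - z ≠ 0 := by
      intro h0; rw [sub_eq_zero] at h0; rw [h0, hz1] at hw; exact lt_irrefl _ hw
    have h1 := (hasSum_geometric_of_norm_lt_one hlt).mul_right (w⁻¹ * g z)
    have e : (1 - z / w)⁻¹ * (w⁻¹ * g z) = g z / (w - z) := by
      rw [one_sub_div hw0]; field_simp
    rw [e] at h1
    refine h1.congr_fun fun l => ?_
    rw [zpow_sub_one₀ hw0, zpow_neg, zpow_natCast, div_pow]
    ring

/-- Double contour integral against the Cauchy kernel `1 / (w - z)` with `‖z‖ < ‖w‖`, the
integration over the larger circle being performed first. -/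
theorem hasSum_doubleIntegral_inner_large {a b ρ ρ' : ℝ} (ha : 0 ≤ a) (ha1 : a < 1) (hb1 : 1 < b)
    (hρ : a < ρ) (hρρ' : ρ < ρ') (hρ' : ρ' < b) {F G : ℂ → ℂ}
    (hF : DifferentiableOn ℂ F (annulus a b)) (hG : DifferentiableOn ℂ G (annulus a b))
    (m n : ℤ) :
    HasSum (fun l : ℕ => fourier F (-m - 1 - l) * fourier G (l - n))
      (((2 * Real.pi * Complex.I) ^ 2)⁻¹ * ∮ z in C(0, ρ), ∮ w in C(0, ρ'),
        (z ^ m * F z) * (w ^ n * G w) / (w - z)) := by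
  have hρ0 : 0 < ρ := ha.trans_lt hρ
  have hρ0' : 0 < ρ' := hρ0.trans hρρ'
  have hFc := hF.continuousOn.mono (sphere_subset_annulus hρ (hρρ'.trans hρ'))
  have hGc := hG.continuousOn.mono (sphere_subset_annulus (hρ.trans hρρ') hρ')
  obtain ⟨C, hC0, hC⟩ := exists_norm_le_on_sphere hFc
  obtain ⟨C', hC0', hC'⟩ := exists_norm_le_on_sphere hGc
  have hzF : ContinuousOn (fun z => z ^ m * F z) (Metric.sphere 0 ρ) :=
    (continuousOn_sphere_zpow hρ0 _).mul hFc
  have hwG : ContinuousOn (fun w => w ^ n * G w) (Metric.sphere 0 ρ') :=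
    (continuousOn_sphere_zpow hρ0' _).mul hGc
  have hc : ∀ l : ℕ, ∮ w in C(0, ρ'), w ^ (-(l : ℤ) - 1) * (w ^ n * G w) =
      2 * Real.pi * Complex.I * fourier G (l - n) := by
    intro l
    rw [show (l - n : ℤ) = -(-l - 1 + n) - 1 by ring,
      ← circleIntegral_zpow_mul ha ha1 hb1 (hρ.trans hρρ') hρ' hG]
    refine circleIntegral.integral_congr hρ0'.le fun w hw => ?_
    have hw0 : w ≠ 0 := norm_pos_iff.1 (mem_sphere_zero_iff_norm.1 hw ▸ hρ0')
    simp only [zpow_add₀ hw0]; ring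
  have h := hasSum_circleIntegral hρ0.le
    (G := fun (l : ℕ) z => (2 * Real.pi * Complex.I * fourier G (l - n)) * (z ^ (m + l) * F z))
    (g := fun z => ∮ w in C(0, ρ'), (z ^ m * F z) * (w ^ n * G w) / (w - z))
    (u := fun l => (ρ / ρ') ^ l * (2 * Real.pi * C' * ρ' ^ n * ρ ^ m * C)) ?_ ?_ ?_ ?_
  · refine (h.mul_left _).congr_fun fun l => ?_
    rw [circleIntegral.integral_const_mul,
      circleIntegral_zpow_mul ha ha1 hb1 hρ (hρρ'.trans hρ') hF,
      show -(m + l) - 1 = -m - 1 - (l : ℤ) by ring]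
    have := Complex.two_pi_I_ne_zero
    field_simp
  · exact fun l => continuousOn_const.mul ((continuousOn_sphere_zpow hρ0 _).mul hFc)
  · intro l z hz
    have hz1 := mem_sphere_zero_iff_norm.1 hz
    have h2 := norm_fourier_le ha ha1 hb1 (hρ.trans hρρ') hρ' hG hC' (l - n)
    have hpi : ‖(2 * Real.pi * Complex.I : ℂ)‖ = 2 * Real.pi := by
      simp [abs_of_pos Real.pi_pos]
    rw [norm_mul, norm_mul _ (fourier G _), norm_mul (_ ^ _), norm_zpow, hz1, hpi]
    refine le_of_le_of_eq (mul_le_mul (mul_le_mul_of_nonneg_left h2 (by positivity))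
      (mul_le_mul_of_nonneg_left (hC z hz) (by positivity)) (by positivity) (by positivity)) ?_
    rw [neg_sub, zpow_sub₀ hρ0'.ne', zpow_add₀ hρ0.ne', zpow_natCast, zpow_natCast, div_pow]
    field_simp
  · exact (summable_geometric_of_lt_one (by positivity) ((div_lt_one hρ0').2 hρρ')).mul_right _
  · intro z hz
    have hz1 := mem_sphere_zero_iff_norm.1 hz
    have hz0 : z ≠ 0 := norm_pos_iff.1 (hz1 ▸ hρ0)
    have h3 := (hasSum_circleIntegral_div_sub_of_lt hwG (hz1 ▸ hρρ' : ‖z‖ < ρ')).mul_left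
      (z ^ m * F z)
    rw [← circleIntegral.integral_const_mul] at h3
    simp only [← mul_div_assoc] at h3
    refine h3.congr_fun fun l => ?_
    rw [hc, zpow_add₀ hz0, zpow_natCast]; ring

/-- Double contour integral against the Cauchy kernel `1 / (w - z)` with `‖z‖ < ‖w‖`, the
integration over the smaller circle being performed first. -/
theorem hasSum_doubleIntegral_inner_small {a b ρ ρ' : ℝ} (ha : 0 ≤ a) (ha1 : a < 1) (hb1 : 1 < b)
    (hρ : a < ρ) (hρρ' : ρ < ρ') (hρ' : ρ' < b) {F G : ℂ → ℂ}
    (hF : DifferentiableOn ℂ F (annulus a b)) (hG : DifferentiableOn ℂ G (annulus a b))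
    (m n : ℤ) :
    HasSum (fun l : ℕ => fourier F (-m - 1 - l) * fourier G (l - n))
      (((2 * Real.pi * Complex.I) ^ 2)⁻¹ * ∮ w in C(0, ρ'), ∮ z in C(0, ρ),
        (z ^ m * F z) * (w ^ n * G w) / (w - z)) := by
  have hρ0 : 0 < ρ := ha.trans_lt hρ
  have hρ0' : 0 < ρ' := hρ0.trans hρρ'
  have hFc := hF.continuousOn.mono (sphere_subset_annulus hρ (hρρ'.trans hρ'))
  have hGc := hG.continuousOn.mono (sphere_subset_annulus (hρ.trans hρρ') hρ')
  obtain ⟨C, hC0, hC⟩ := exists_norm_le_on_sphere hFc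
  obtain ⟨C', hC0', hC'⟩ := exists_norm_le_on_sphere hGc
  have hzF : ContinuousOn (fun z => z ^ m * F z) (Metric.sphere 0 ρ) :=
    (continuousOn_sphere_zpow hρ0 _).mul hFc
  have hc : ∀ l : ℕ, ∮ z in C(0, ρ), z ^ l * (z ^ m * F z) =
      2 * Real.pi * Complex.I * fourier F (-m - 1 - l) := by
    intro l
    rw [show (-m - 1 - l : ℤ) = -(l + m) - 1 by ring,
      ← circleIntegral_zpow_mul ha ha1 hb1 hρ (hρρ'.trans hρ') hF]
    refine circleIntegral.integral_congr hρ0.le fun z hz => ?_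
    have hz0 : z ≠ 0 := norm_pos_iff.1 (mem_sphere_zero_iff_norm.1 hz ▸ hρ0)
    simp only [zpow_add₀ hz0, zpow_natCast]; ring
  have h := hasSum_circleIntegral hρ0'.le
    (G := fun (l : ℕ) w => (2 * Real.pi * Complex.I * fourier F (-m - 1 - l)) *
      (w ^ (n - l - 1) * G w))
    (g := fun w => ∮ z in C(0, ρ), (z ^ m * F z) * (w ^ n * G w) / (w - z))
    (u := fun l => (ρ / ρ') ^ l * (2 * Real.pi * C * ρ' ^ (n - 1) * ρ ^ (m + 1) * C')) ?_ ?_ ?_ ?_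
  · refine (h.mul_left _).congr_fun fun l => ?_
    rw [circleIntegral.integral_const_mul,
      circleIntegral_zpow_mul ha ha1 hb1 (hρ.trans hρρ') hρ' hG,
      show -(n - l - 1) - 1 = (l : ℤ) - n by ring]
    have := Complex.two_pi_I_ne_zero
    field_simp
  · exact fun l => continuousOn_const.mul ((continuousOn_sphere_zpow hρ0' _).mul hGc)
  · intro l w hw
    have hw1 := mem_sphere_zero_iff_norm.1 hw
    have h2 := norm_fourier_le ha ha1 hb1 hρ (hρρ'.trans hρ') hF hC (-m - 1 - l)
    have hpi : ‖(2 * Real.pi * Complex.I : ℂ)‖ = 2 * Real.pi := by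
      simp [abs_of_pos Real.pi_pos]
    rw [norm_mul, norm_mul _ (fourier F _), norm_mul (_ ^ _), norm_zpow, hw1, hpi]
    refine le_of_le_of_eq (mul_le_mul (mul_le_mul_of_nonneg_left h2 (by positivity))
      (mul_le_mul_of_nonneg_left (hC' w hw) (by positivity)) (by positivity) (by positivity)) ?_
    rw [show -(-m - 1 - (l : ℤ)) = l + (m + 1) by ring, show n - l - 1 = (n - 1) - (l : ℤ) by ring,
      zpow_add₀ hρ0.ne', zpow_sub₀ hρ0'.ne' (n - 1), zpow_natCast, zpow_natCast, div_pow]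
    field_simp
  · exact (summable_geometric_of_lt_one (by positivity) ((div_lt_one hρ0').2 hρρ')).mul_right _
  · intro w hw
    have hw1 := mem_sphere_zero_iff_norm.1 hw
    have hw0 : w ≠ 0 := norm_pos_iff.1 (hw1 ▸ hρ0')
    have h3 := (hasSum_circleIntegral_div_sub_of_gt hρ0 hzF (hw1 ▸ hρρ' : ρ < ‖w‖)).mul_left
      (w ^ n * G w)
    rw [← circleIntegral.integral_const_mul] at h3
    simp only [← mul_div_assoc, fun z => mul_comm (w ^ n * G w) (z ^ m * F z)] at h3
    refine h3.congr_fun fun l => ?_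
    rw [hc, show n - l - 1 = n + (-(l : ℤ) - 1) by ring, zpow_add₀ hw0 n]; ring

/-! ### Operators on spaces of square summable sequences -/

/-- `ℓ²(ι)`. -/
abbrev SeqSpace (ι : Type*) : Type _ := lp (fun _ : ι => ℂ) 2

/-- The unit vectors of `ℓ²(ι)`. -/
def unitVec {ι : Type*} [DecidableEq ι] (i : ι) : SeqSpace ι := lp.single 2 i (1 : ℂ)

theorem unitVec_apply {ι : Type*} [DecidableEq ι] (i j : ι) :
    unitVec i j = if j = i then 1 else 0 := by
  simp [unitVec, Pi.single_apply]

theorem hasSum_unitVec {ι : Type*} [DecidableEq ι] (x : SeqSpace ι) :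
    HasSum (fun i => x i • unitVec i) x := by
  refine (lp.hasSum_single (p := 2) (by simp) x).congr_fun fun i => ?_
  rw [unitVec, ← lp.single_smul, smul_eq_mul, mul_one]

theorem hasSum_functional {ι : Type*} [DecidableEq ι] (T : SeqSpace ι →L[ℂ] ℂ) (x : SeqSpace ι) :
    HasSum (fun i => x i * T (unitVec i)) (T x) := by
  simpa using (hasSum_unitVec x).mapL T

/-- Evaluation of a square summable sequence at an index. -/
def evalAt {ι : Type*} (j : ι) : SeqSpace ι →L[ℂ] ℂ := lp.evalCLM ℂ (fun _ : ι => ℂ) 2 j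

@[simp] theorem evalAt_apply {ι : Type*} (j : ι) (x : SeqSpace ι) : evalAt j x = x j := rfl

theorem hasSum_entry {ι κ : Type*} [DecidableEq ι] (T : SeqSpace ι →L[ℂ] SeqSpace κ)
    (x : SeqSpace ι) (j : κ) : HasSum (fun i => T (unitVec i) j * x i) (T x j) := by
  simpa [mul_comm] using hasSum_functional ((evalAt j).comp T) x

theorem ext_entry {ι κ : Type*} [DecidableEq ι] {T S : SeqSpace ι →L[ℂ] SeqSpace κ}
    (h : ∀ i j, T (unitVec i) j = S (unitVec i) j) : T = S := by
  ext x j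
  refine (hasSum_entry T x j).unique ?_
  simp only [h]
  exact hasSum_entry S x j

theorem sum_norm_elim_le {ι κ : Type*} (σ : ι → Option κ)
    (hσ : ∀ i j k, σ i = some k → σ j = some k → i = j) (x : SeqSpace κ) (s : Finset ι) :
    ∑ i ∈ s, ‖(σ i).elim 0 x‖ ^ (2 : ENNReal).toReal ≤ ‖x‖ ^ (2 : ENNReal).toReal := by
  classical
  have hp : 0 < (2 : ENNReal).toReal := by norm_num
  let ψ : Option κ → ℝ := fun o => ‖o.elim 0 x‖ ^ (2 : ENNReal).toReal
  have hψ0 : ∀ o, 0 ≤ ψ o := fun o => by positivity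
  have hnone : ψ none = 0 := by simp [ψ]
  calc ∑ i ∈ s, ψ (σ i) = ∑ i ∈ s with σ i ≠ none, ψ (σ i) := by
        refine (Finset.sum_filter_of_ne (p := fun i => σ i ≠ none) fun i _ hi h0 => hi ?_).symm
        rw [h0, hnone]
    _ = ∑ o ∈ (s.filter fun i => σ i ≠ none).image σ, ψ o := by
        refine (Finset.sum_image fun i hi j _ hij => ?_).symm
        obtain ⟨k, hk⟩ := Option.ne_none_iff_exists'.1 (Finset.mem_filter.1 hi).2
        exact hσ i j k hk (hij ▸ hk)
    _ ≤ ∑ o ∈ Finset.insertNone (Finset.eraseNone ((s.filter fun i => σ i ≠ none).image σ)),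
          ψ o := by
        refine Finset.sum_le_sum_of_subset_of_nonneg ?_ fun o _ _ => hψ0 o
        rw [Finset.insertNone_eraseNone]
        exact Finset.subset_insert _ _
    _ = ∑ k ∈ Finset.eraseNone ((s.filter fun i => σ i ≠ none).image σ),
          ‖x k‖ ^ (2 : ENNReal).toReal := by
        rw [Finset.sum_insertNone, hnone, zero_add]; rfl
    _ ≤ ‖x‖ ^ (2 : ENNReal).toReal := lp.sum_rpow_le_norm_rpow hp x _

/-- The contraction `ℓ²(κ) → ℓ²(ι)` that pulls sequences back along an injective partial map
`σ : ι → κ` and fills up with zeros. Shifts, restrictions and extensions by zero are of this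
form. -/
def pull {ι κ : Type*} (σ : ι → Option κ)
    (hσ : ∀ i j k, σ i = some k → σ j = some k → i = j) : SeqSpace κ →L[ℂ] SeqSpace ι :=
  LinearMap.mkContinuous
    { toFun := fun x => ⟨fun i => (σ i).elim 0 x, memℓp_gen' (sum_norm_elim_le σ hσ x)⟩
      map_add' := fun x y => by
        ext i
        change (σ i).elim 0 ⇑(x + y) = (σ i).elim 0 ⇑x + (σ i).elim 0 ⇑y
        rcases σ i with _ | k
        · exact (add_zero 0).symm
        · rfl
      map_smul' := fun c x => by
        ext i
        change (σ i).elim 0 ⇑(c • x) = c * (σ i).elim 0 ⇑x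
        rcases σ i with _ | k
        · exact (mul_zero c).symm
        · rfl } 1
    fun x => by
      rw [one_mul]
      exact lp.norm_le_of_forall_sum_le (by norm_num) (norm_nonneg x) (sum_norm_elim_le σ hσ x)

theorem pull_apply {ι κ : Type*} (σ : ι → Option κ)
    (hσ : ∀ i j k, σ i = some k → σ j = some k → i = j) (x : SeqSpace κ) (i : ι) :
    pull σ hσ x i = (σ i).elim 0 x := rfl

theorem norm_pull_le {ι κ : Type*} (σ : ι → Option κ)
    (hσ : ∀ i j k, σ i = some k → σ j = some k → i = j) : ‖pull σ hσ‖ ≤ 1 :=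
  LinearMap.mkContinuous_norm_le _ zero_le_one _

/-- The shift by `k` on `ℓ²(ℕ)`, with matrix entry `1` at `(i, j)` if `i - j = k`. -/
def shiftOp (k : ℤ) : SeqSpace ℕ →L[ℂ] SeqSpace ℕ :=
  pull (fun n : ℕ => if 0 ≤ (n : ℤ) - k then some ((n : ℤ) - k).toNat else none) (by
    intro i j m hi hj
    split_ifs at hi hj
    simp only [Option.some.injEq] at hi hj
    omega)

theorem shiftOp_unitVec (k : ℤ) (m n : ℕ) :
    shiftOp k (unitVec m) n = if k = (n : ℤ) - m then 1 else 0 := by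
  rw [shiftOp, pull_apply]
  split_ifs with h1 h2 h2
  · simp only [Option.elim_some, unitVec_apply]
    rw [if_pos (by omega)]
  · simp only [Option.elim_some, unitVec_apply]
    rw [if_neg (by omega)]
  · omega
  · rfl

/-- The Toeplitz operator on `ℓ²(ℕ)` with symbol `F`. -/
def toeplitzOp (F : ℂ → ℂ) : SeqSpace ℕ →L[ℂ] SeqSpace ℕ := ∑' k : ℤ, fourier F k • shiftOp k

theorem toeplitzOp_unitVec {a b : ℝ} (ha : 0 ≤ a) (ha1 : a < 1) (hb1 : 1 < b)
    {F : ℂ → ℂ} (hF : DifferentiableOn ℂ F (annulus a b)) (m n : ℕ) :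
    toeplitzOp F (unitVec m) n = fourier F ((n : ℤ) - m) := by
  have hs : Summable fun k : ℤ => fourier F k • shiftOp k := by
    refine Summable.of_norm_bounded (summable_fourier ha ha1 hb1 hF) fun k => ?_
    rw [norm_smul]
    exact mul_le_of_le_one_right (norm_nonneg _) (norm_pull_le _ _)
  have h := hs.hasSum.mapL ((evalAt n).comp (ContinuousLinearMap.apply ℂ (SeqSpace ℕ) (unitVec m)))
  refine h.unique ?_
  convert! hasSum_ite_eq ((n : ℤ) - m) (fourier F ((n : ℤ) - m)) using 2 with k
  change (fourier F k • shiftOp k (unitVec m)) n = _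
  change fourier F k * shiftOp k (unitVec m) n = _
  rw [shiftOp_unitVec]
  split_ifs with h
  · rw [h, mul_one]
  · rw [mul_zero]

theorem hasSum_toeplitzOp_mul {a b : ℝ} (ha : 0 ≤ a) (ha1 : a < 1) (hb1 : 1 < b)
    {F G : ℂ → ℂ} (hF : DifferentiableOn ℂ F (annulus a b))
    (hG : DifferentiableOn ℂ G (annulus a b)) (j k : ℕ) :
    HasSum (fun l : ℕ => fourier F ((j : ℤ) - l) * fourier G ((l : ℤ) - k))
      ((toeplitzOp F * toeplitzOp G) (unitVec k) j) := by
  have h := hasSum_entry (toeplitzOp F) (toeplitzOp G (unitVec k)) j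
  simp only [toeplitzOp_unitVec ha ha1 hb1 hF, toeplitzOp_unitVec ha ha1 hb1 hG] at h
  exact h

theorem hasSum_fourier_mul_shift {a b : ℝ} (ha : 0 ≤ a) (ha1 : a < 1) (hb1 : 1 < b)
    {F G : ℂ → ℂ} (hF : DifferentiableOn ℂ F (annulus a b))
    (hG : DifferentiableOn ℂ G (annulus a b)) (j k : ℤ) :
    HasSum (fun l : ℤ => fourier F (j - l) * fourier G (l - k))
      (fourier (fun z => F z * G z) (j - k)) := by
  have h := hasSum_fourier_mul ha ha1 hb1 hF hG (j - k)
  rw [← (Equiv.subRight k).hasSum_iff] at h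
  refine h.congr_fun fun l => ?_
  simp only [Function.comp, Equiv.subRight_apply]
  congr 2; ring

/-- Widom's identity `T(FG) = T(F) T(G) + H(F) H(G~)`, entry by entry. -/
theorem fourier_mul_eq_add {a b : ℝ} (ha : 0 ≤ a) (ha1 : a < 1) (hb1 : 1 < b)
    {F G : ℂ → ℂ} (hF : DifferentiableOn ℂ F (annulus a b))
    (hG : DifferentiableOn ℂ G (annulus a b)) (j k : ℕ) {y : ℂ}
    (hy : HasSum (fun l : ℕ => fourier F ((j : ℤ) + l + 1) * fourier G (-(l : ℤ) - 1 - k)) y) :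
    fourier (fun z => F z * G z) ((j : ℤ) - k) =
      (toeplitzOp F * toeplitzOp G) (unitVec k) j + y := by
  refine (hasSum_fourier_mul_shift ha ha1 hb1 hF hG j k).unique ?_
  refine HasSum.of_nat_of_neg_add_one (hasSum_toeplitzOp_mul ha ha1 hb1 hF hG j k) ?_
  refine hy.congr_fun fun l => ?_
  congr 2
  all_goals ring

/-- Toeplitz operators are multiplicative if the left symbol has no positive coefficients or the
right one has no negative coefficients. -/
theorem toeplitzOp_mul {a b : ℝ} (ha : 0 ≤ a) (ha1 : a < 1) (hb1 : 1 < b)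
    {F G : ℂ → ℂ} (hF : DifferentiableOn ℂ F (annulus a b))
    (hG : DifferentiableOn ℂ G (annulus a b))
    (h : (∀ k, 0 < k → fourier F k = 0) ∨ (∀ k, k < 0 → fourier G k = 0)) :
    toeplitzOp F * toeplitzOp G = toeplitzOp fun z => F z * G z := by
  refine ext_entry fun k j => ?_
  rw [toeplitzOp_unitVec ha ha1 hb1 (F := fun z => F z * G z) (hF.mul hG),
    fourier_mul_eq_add ha ha1 hb1 hF hG (y := 0), add_zero]
  refine hasSum_zero.congr_fun fun l => ?_
  rcases h with h | h
  · rw [h _ (by omega), zero_mul]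
  · rw [h (_ - _ - _) (by omega), mul_zero]

theorem toeplitzOp_congr {F G : ℂ → ℂ} (h : ∀ z : ℂ, ‖z‖ = 1 → F z = G z) :
    toeplitzOp F = toeplitzOp G := by
  simp only [toeplitzOp, fourier_congr h]

theorem fourier_one (k : ℤ) : fourier (fun _ => 1) k = if k = 0 then 1 else 0 := by
  obtain ⟨n, rfl⟩ : ∃ n : ℤ, k = -n - 1 := ⟨-k - 1, by ring⟩
  rw [fourier_eq]
  simp only [mul_one]
  split_ifs with h
  · obtain rfl : n = -1 := by omega
    have := circleIntegral.integral_sub_center_inv 0 (one_ne_zero (α := ℝ))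
    simp only [sub_zero] at this
    simp only [zpow_neg_one, this]
    exact inv_mul_cancel₀ Complex.two_pi_I_ne_zero
  · have := circleIntegral.integral_sub_zpow_of_ne (n := n) (by omega) 0 0 1
    simp only [sub_zero] at this
    rw [this, mul_zero]

theorem toeplitzOp_one : toeplitzOp (fun _ => 1) = 1 := by
  refine ext_entry fun k j => ?_
  rw [toeplitzOp_unitVec (le_refl (0 : ℝ)) zero_lt_one one_lt_two (differentiableOn_const _),
    fourier_one]
  change _ = unitVec k j
  rw [unitVec_apply]
  congr 1
  simp only [eq_iff_iff]
  omega

/-! ### Compression to the tail and the Schur complement -/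

/-- Restriction of a sequence to the indices `≥ M`. -/
def tailRestrict (M : ℕ) : SeqSpace ℕ →L[ℂ] TailSpace M :=
  pull (fun i : Set.Ici M => some (i : ℕ)) (by
    intro i j k hi hj
    exact Subtype.ext (Option.some.inj (hi.trans hj.symm)))

/-- Extension by zero of a sequence on the indices `≥ M`. -/
def tailExtend (M : ℕ) : TailSpace M →L[ℂ] SeqSpace ℕ :=
  pull (fun n : ℕ => if h : M ≤ n then some (⟨n, h⟩ : Set.Ici M) else none) (by
    intro i j k hi hj
    split_ifs at hi hj
    have h := Option.some.inj (hi.trans hj.symm)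
    exact congrArg Subtype.val h)

@[simp] theorem tailRestrict_apply (M : ℕ) (x : SeqSpace ℕ) (i : Set.Ici M) :
    tailRestrict M x i = x i := rfl

theorem tailExtend_apply_of_le {M n : ℕ} (h : M ≤ n) (x : TailSpace M) :
    tailExtend M x n = x ⟨n, h⟩ := by
  rw [tailExtend, pull_apply, dif_pos h, Option.elim_some]

theorem tailExtend_apply_of_lt {M n : ℕ} (h : n < M) (x : TailSpace M) :
    tailExtend M x n = 0 := by
  rw [tailExtend, pull_apply, dif_neg (by omega), Option.elim_none]

theorem tailExtend_unitVec {M : ℕ} (k : Set.Ici M) :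
    tailExtend M (unitVec k) = unitVec (k : ℕ) := by
  ext n
  rw [unitVec_apply]
  rcases le_or_gt M n with h | h
  · rw [tailExtend_apply_of_le h, unitVec_apply]
    simp [Subtype.ext_iff]
  · rw [tailExtend_apply_of_lt h, if_neg]
    rintro rfl
    exact absurd k.2 (not_le.2 h)

theorem tailRestrict_tailExtend (M : ℕ) (x : TailSpace M) :
    tailRestrict M (tailExtend M x) = x := by
  ext i
  rw [tailRestrict_apply, tailExtend_apply_of_le i.2]

/-- The first `M` entries of a sequence. -/
def headRestrict (M : ℕ) : SeqSpace ℕ →L[ℂ] (Fin M → ℂ) :=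
  ContinuousLinearMap.pi fun i => evalAt (i : ℕ)

/-- The sequence with prescribed first `M` entries and no others. -/
def headExtend (M : ℕ) : (Fin M → ℂ) →L[ℂ] SeqSpace ℕ :=
  ∑ i : Fin M, (ContinuousLinearMap.proj i : (Fin M → ℂ) →L[ℂ] ℂ).smulRight (unitVec (i : ℕ))

@[simp] theorem headRestrict_apply (M : ℕ) (x : SeqSpace ℕ) (i : Fin M) :
    headRestrict M x i = x i := rfl

theorem headExtend_apply (M : ℕ) (w : Fin M → ℂ) :
    headExtend M w = ∑ i : Fin M, w i • unitVec (i : ℕ) := by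
  simp [headExtend]

theorem headExtend_apply_apply (M : ℕ) (w : Fin M → ℂ) (n : ℕ) :
    headExtend M w n = if h : n < M then w ⟨n, h⟩ else 0 := by
  rw [headExtend_apply]
  change evalAt n _ = _
  rw [map_sum]
  simp only [map_smul, evalAt_apply, unitVec_apply, smul_eq_mul, mul_ite, mul_one, mul_zero]
  split_ifs with h
  · rw [Finset.sum_eq_single ⟨n, h⟩] <;> simp [Fin.ext_iff]
    intro b hb hb'
    omega
  · exact Finset.sum_eq_zero fun i _ => if_neg (by omega)

theorem headExtend_add_tailExtend (M : ℕ) (x : SeqSpace ℕ) :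
    headExtend M (headRestrict M x) + tailExtend M (tailRestrict M x) = x := by
  ext n
  change headExtend M _ n + tailExtend M _ n = x n
  rw [headExtend_apply_apply]
  rcases le_or_gt M n with h | h
  · rw [dif_neg (by omega), tailExtend_apply_of_le h, zero_add]; rfl
  · rw [dif_pos h, tailExtend_apply_of_lt h, add_zero]; rfl

theorem tailExtend_tailRestrict (M : ℕ) (x : SeqSpace ℕ) :
    tailExtend M (tailRestrict M x) = x - headExtend M (headRestrict M x) :=
  eq_sub_of_add_eq' (headExtend_add_tailExtend M x)

/-- The operator form of the Borodin–Okounkov identity. Here `U` is upper and `D` lower triangular,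
both with inverses of the same shape, so that `A = U D` plays the role of a Toeplitz operator with
its Wiener–Hopf factorization; `G` inverts the leading `M × M` block of `A`. The compression of
`U D⁻¹ U⁻¹ D = U A⁻¹ D` to the tail is then invertible: its inverse is the compression of
`D⁻¹ C U⁻¹`, where `C = A - A G A` is the Schur complement of the leading block of `A`. -/
theorem isUnit_compression_and_inverse {M : ℕ} {U U' D D' : SeqSpace ℕ →L[ℂ] SeqSpace ℕ}
    (hUU' : U * U' = 1) (hU'U : U' * U = 1) (hDD' : D * D' = 1) (hD'D : D' * D = 1)
    (hU : ∀ w, tailRestrict M (U (headExtend M w)) = 0)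
    (hU' : ∀ w, tailRestrict M (U' (headExtend M w)) = 0)
    (hD : ∀ x, headRestrict M (D (tailExtend M x)) = 0)
    (hD' : ∀ x, headRestrict M (D' (tailExtend M x)) = 0)
    {G : (Fin M → ℂ) →L[ℂ] (Fin M → ℂ)}
    (hG : ∀ w, headRestrict M (U (D (headExtend M (G w)))) = w)
    (hG' : ∀ w, G (headRestrict M (U (D (headExtend M w)))) = w)
    {B : TailSpace M →L[ℂ] TailSpace M}
    (hB : ∀ x, B x = tailRestrict M (U (D' (U' (D (tailExtend M x)))))) :
    IsUnit B ∧ ∀ x, U' (D (tailExtend M (Ring.inverse B (tailRestrict M (U (D' x)))))) =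
      x - D (headExtend M (G (headRestrict M (U x)))) := by
  replace hUU' : ∀ x, U (U' x) = x := fun x => DFunLike.congr_fun hUU' x
  replace hU'U : ∀ x, U' (U x) = x := fun x => DFunLike.congr_fun hU'U x
  replace hDD' : ∀ x, D (D' x) = x := fun x => DFunLike.congr_fun hDD' x
  replace hD'D : ∀ x, D' (D x) = x := fun x => DFunLike.congr_fun hD'D x
  let C : SeqSpace ℕ →L[ℂ] SeqSpace ℕ :=
    U.comp D - (U.comp D).comp ((headExtend M).comp (G.comp ((headRestrict M).comp (U.comp D))))
  have hC : ∀ x, C x = U (D x) - U (D (headExtend M (G (headRestrict M (U (D x)))))) := fun _ => rfl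
  let N : TailSpace M →L[ℂ] TailSpace M :=
    (tailRestrict M).comp (D'.comp (C.comp (U'.comp (tailExtend M))))
  have hN : ∀ x, N x = tailRestrict M (D' (C (U' (tailExtend M x)))) := fun _ => rfl
  have hπC : ∀ x, headRestrict M (C x) = 0 := fun x => by rw [hC, map_sub, hG, sub_self]
  have hCι : ∀ w, C (headExtend M w) = 0 := fun w => by rw [hC, hG', sub_self]
  have hCU'ι : ∀ w, C (U' (headExtend M w)) = 0 := fun w => by
    rw [← headExtend_add_tailExtend M (U' (headExtend M w)), hU', map_zero, add_zero, hCι]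
  have hCU' : ∀ x, C (U' (tailExtend M (tailRestrict M x))) = C (U' x) := fun x => by
    rw [tailExtend_tailRestrict, map_sub, map_sub, hCU'ι, sub_zero]
  have hEN : ∀ x, tailExtend M (N x) = D' (C (U' (tailExtend M x))) := fun x => by
    rw [hN, tailExtend_tailRestrict]
    have h0 : headRestrict M (D' (C (U' (tailExtend M x)))) = 0 := by
      rw [← headExtend_add_tailExtend M (C (U' (tailExtend M x))), hπC, map_zero, zero_add, hD']
    rw [h0, map_zero, sub_zero]
  have hBN : B * N = 1 := by
    refine ContinuousLinearMap.ext fun x => ?_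
    change B (N x) = x
    rw [hB, hEN, hDD', hC, map_sub, map_sub, hU'U, hU'U, hD'D, hD'D, map_sub, map_sub, hU, sub_zero,
      hUU', tailRestrict_tailExtend]
  have hNB : N * B = 1 := by
    refine ContinuousLinearMap.ext fun x => ?_
    change N (B x) = x
    rw [hN, hB, hCU', hU'U, hC, hDD', hUU', hD, map_zero, map_zero, map_zero, map_zero, sub_zero,
      hD'D, tailRestrict_tailExtend]
  refine ⟨⟨⟨B, N, hBN, hNB⟩, rfl⟩, fun x => ?_⟩
  have hinv : Ring.inverse B = N := Ring.inverse_unit ⟨B, N, hBN, hNB⟩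
  rw [hinv, hEN, hDD', hCU', hU'U, hC, hDD', map_sub, hU'U, hU'U]

/-! ### Wiener–Hopf factors of products of symbols -/

theorem chain_mul_chain (φ : ℤ → ℂ → ℂ) {r s t : ℤ} (hrs : r ≤ s) (hst : s ≤ t) (z : ℂ) :
    chain φ r s z * chain φ s t z = chain φ r t z := by
  rw [chain, chain, chain, ← Finset.prod_union, Finset.Ico_union_Ico_eq_Ico hrs hst]
  exact Finset.Ico_disjoint_Ico_consecutive r s t

/-- `f = fp * fm` on the unit circle, with `fp` analytic and non-zero in `‖z‖ < b` and `fm` analytic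
and non-zero in `‖z‖ > a` and convergent to `1` at infinity. -/
structure Factorization (a b : ℝ) (f fp fm : ℂ → ℂ) : Prop where
  factor : ∀ z : ℂ, ‖z‖ = 1 → f z = fp z * fm z
  plus : DifferentiableOn ℂ fp (Metric.ball 0 b)
  plus_ne : ∀ z ∈ Metric.ball (0 : ℂ) b, fp z ≠ 0
  minus : DifferentiableOn ℂ fm {z | a < ‖z‖}
  minus_ne : ∀ z : ℂ, a < ‖z‖ → fm z ≠ 0
  minus_infty : Filter.Tendsto fm (Bornology.cobounded ℂ) (nhds 1)

theorem WienerHopf.factorization {ε : ℝ} {f fp fm : ℂ → ℂ} (h : WienerHopf ε f fp fm) :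
    Factorization (max 0 (1 - ε)) (1 + ε) f fp fm where
  factor := h.factor
  plus := fun z hz =>
    (h.analytic_plus z (mem_ball_zero_iff.1 hz)).differentiableAt.differentiableWithinAt
  plus_ne := fun z hz => h.ne_zero_plus z (mem_ball_zero_iff.1 hz)
  minus := fun z hz =>
    (h.analytic_minus z ((le_max_right 0 (1 - ε)).trans_lt (show _ < ‖z‖ from hz))).differentiableAt.differentiableWithinAt
  minus_ne := fun z hz => h.ne_zero_minus z ((le_max_right _ _).trans_lt hz)
  minus_infty := h.minus_infty

theorem Factorization.chain {a b : ℝ} {φ φp φm : ℤ → ℂ → ℂ} {r s : ℤ}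
    (h : ∀ q, r ≤ q → q < s → Factorization a b (φ q) (φp q) (φm q)) :
    Factorization a b (chain φ r s) (chain φp r s) (chain φm r s) := by
  have h' : ∀ q ∈ Finset.Ico r s, Factorization a b (φ q) (φp q) (φm q) := fun q hq =>
    h q (Finset.mem_Ico.1 hq).1 (Finset.mem_Ico.1 hq).2
  refine ⟨fun z hz => ?_, ?_, fun z hz => ?_, ?_, fun z hz => ?_, ?_⟩
  · rw [ToeplitzPaths.chain, ToeplitzPaths.chain, ToeplitzPaths.chain, ← Finset.prod_mul_distrib]
    exact Finset.prod_congr rfl fun q hq => (h' q hq).factor z hz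
  · exact DifferentiableOn.fun_finsetProd fun q hq => (h' q hq).plus
  · exact Finset.prod_ne_zero_iff.2 fun q hq => (h' q hq).plus_ne z hz
  · exact DifferentiableOn.fun_finsetProd fun q hq => (h' q hq).minus
  · exact Finset.prod_ne_zero_iff.2 fun q hq => (h' q hq).minus_ne z hz
  · have := tendsto_finsetProd (Finset.Ico r s) fun q hq => (h' q hq).minus_infty
    rw [Finset.prod_const_one] at this
    exact this

theorem annulus_subset_ball (a b : ℝ) : annulus a b ⊆ Metric.ball 0 b := fun _ hz =>
  mem_ball_zero_iff.2 hz.2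

namespace Factorization

theorem plus_annulus {a b : ℝ} {f fp fm : ℂ → ℂ} (h : Factorization a b f fp fm) :
    DifferentiableOn ℂ fp (annulus a b) := h.plus.mono (annulus_subset_ball a b)

theorem plus_inv {a b : ℝ} {f fp fm : ℂ → ℂ} (h : Factorization a b f fp fm) :
    DifferentiableOn ℂ (fun z => (fp z)⁻¹) (Metric.ball 0 b) :=
  h.plus.inv h.plus_ne

theorem plus_inv_annulus {a b : ℝ} {f fp fm : ℂ → ℂ} (h : Factorization a b f fp fm) :
    DifferentiableOn ℂ (fun z => (fp z)⁻¹) (annulus a b) :=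
  h.plus_inv.mono (annulus_subset_ball a b)

theorem minus_annulus {a b : ℝ} {f fp fm : ℂ → ℂ} (h : Factorization a b f fp fm) :
    DifferentiableOn ℂ fm (annulus a b) := h.minus.mono fun _ hz => hz.1

theorem minus_inv {a b : ℝ} {f fp fm : ℂ → ℂ} (h : Factorization a b f fp fm) :
    DifferentiableOn ℂ (fun z => (fm z)⁻¹) {z | a < ‖z‖} :=
  h.minus.inv h.minus_ne

theorem minus_inv_annulus {a b : ℝ} {f fp fm : ℂ → ℂ} (h : Factorization a b f fp fm) :
    DifferentiableOn ℂ (fun z => (fm z)⁻¹) (annulus a b) :=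
  h.minus_inv.mono fun _ hz => hz.1

theorem minus_inv_infty {a b : ℝ} {f fp fm : ℂ → ℂ} (h : Factorization a b f fp fm) :
    Filter.Tendsto (fun z => (fm z)⁻¹) (Bornology.cobounded ℂ) (nhds 1) := by
  simpa using h.minus_infty.inv₀ one_ne_zero

theorem annulus {a b : ℝ} {f fp fm : ℂ → ℂ} (h : Factorization a b f fp fm) :
    DifferentiableOn ℂ (fun z => fp z * fm z) (annulus a b) :=
  h.plus_annulus.mul h.minus_annulus

end Factorization

theorem differentiableOn_zpow_mul {a b : ℝ} (ha : 0 ≤ a) {F : ℂ → ℂ}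
    (hF : DifferentiableOn ℂ F (annulus a b)) (n : ℤ) :
    DifferentiableOn ℂ (fun z => z ^ n * F z) (annulus a b) :=
  DifferentiableOn.mul (fun _ hz => (differentiableAt_zpow.2
    (Or.inl (norm_pos_iff.1 (ha.trans_lt hz.1)))).differentiableWithinAt) hF

theorem fourier_zpow_mul (F : ℂ → ℂ) (n k : ℤ) :
    fourier (fun z => z ^ n * F z) k = fourier F (k - n) := by
  unfold fourier
  congr 1
  refine circleIntegral.integral_congr zero_le_one fun z hz => ?_
  have hz0 : z ≠ 0 := by rintro rfl; simp at hz
  simp only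
  rw [neg_sub, sub_eq_add_neg, zpow_add₀ hz0]
  ring

/-! ### The Borodin–Okounkov formula for the kernel -/

theorem tailRestrict_toeplitzOp_headExtend {a b : ℝ} (ha : 0 ≤ a) (ha1 : a < 1) (hb1 : 1 < b)
    {F : ℂ → ℂ} (hF : DifferentiableOn ℂ F (annulus a b)) (h : ∀ k, 0 < k → fourier F k = 0)
    {M : ℕ} (w : Fin M → ℂ) : tailRestrict M (toeplitzOp F (headExtend M w)) = 0 := by
  ext i
  rw [tailRestrict_apply, headExtend_apply, map_sum]
  change evalAt (i : ℕ) _ = 0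
  rw [map_sum]
  refine Finset.sum_eq_zero fun j _ => ?_
  have hi : M ≤ i := i.2
  rw [map_smul, map_smul, evalAt_apply, toeplitzOp_unitVec ha ha1 hb1 hF, h _ (by omega), smul_zero]

theorem headRestrict_toeplitzOp_tailExtend {a b : ℝ} (ha : 0 ≤ a) (ha1 : a < 1) (hb1 : 1 < b)
    {F : ℂ → ℂ} (hF : DifferentiableOn ℂ F (annulus a b)) (h : ∀ k, k < 0 → fourier F k = 0)
    {M : ℕ} (x : TailSpace M) : headRestrict M (toeplitzOp F (tailExtend M x)) = 0 := by
  ext i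
  rw [headRestrict_apply]
  refine (hasSum_entry _ _ _).unique (hasSum_zero.congr_fun fun n => ?_)
  rcases le_or_gt M n with hn | hn
  · rw [toeplitzOp_unitVec ha ha1 hb1 hF, h _ (by omega), zero_mul]
  · rw [tailExtend_apply_of_lt hn, mul_zero]

/-- The compression of `T(fm / fp) T(fp / fm)` to the tail, which turns out to be `I - 𝒦₀`. -/
def compression (M : ℕ) (fp fm : ℂ → ℂ) : TailSpace M →L[ℂ] TailSpace M :=
  (tailRestrict M).comp ((toeplitzOp fun z => fm z * (fp z)⁻¹).comp
    ((toeplitzOp fun z => (fm z)⁻¹ * fp z).comp (tailExtend M)))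

theorem compression_apply (M : ℕ) (fp fm : ℂ → ℂ) (x : TailSpace M) :
    compression M fp fm x = tailRestrict M (toeplitzOp (fun z => fm z * (fp z)⁻¹)
      (toeplitzOp (fun z => (fm z)⁻¹ * fp z) (tailExtend M x))) := rfl

/-- The operator given by the inverse of the finite Toeplitz matrix. -/
def toeplitzInv (M : ℕ) (f : ℂ → ℂ) : (Fin M → ℂ) →L[ℂ] (Fin M → ℂ) :=
  LinearMap.toContinuousLinearMap (Matrix.mulVecLin (toeplitz M f)⁻¹)

theorem toeplitzInv_apply (M : ℕ) (f : ℂ → ℂ) (w : Fin M → ℂ) :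
    toeplitzInv M f w = Matrix.mulVec (toeplitz M f)⁻¹ w := rfl

/-- A Borodin–Okounkov identity: the inverse of the finite Toeplitz matrix, between the row
`T(f) T(fp)` and the column `T(fm) T(g)`, in terms of the inverse of the compression of
`T(fm / fp) T(fp / fm)` to the tail. -/
theorem borodin_okounkov {a b : ℝ} (ha : 0 ≤ a) (ha1 : a < 1) (hb1 : 1 < b) {φ fp fm : ℂ → ℂ}
    (h : Factorization a b φ fp fm) {M : ℕ} (hdet : IsUnit (toeplitz M φ).det) :
    IsUnit (compression M fp fm) ∧ ∀ f g : ℂ → ℂ, DifferentiableOn ℂ f (annulus a b) →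
      DifferentiableOn ℂ g (annulus a b) →
      ((toeplitzOp f) ((toeplitzOp fun z => (fm z)⁻¹ * fp z) (tailExtend M
        (Ring.inverse (compression M fp fm) (tailRestrict M
          ((toeplitzOp fun z => fm z * (fp z)⁻¹) (toeplitzOp g (unitVec 0)))))))) 0 =
      (toeplitzOp f * toeplitzOp g) (unitVec 0) 0 -
        ∑ i : Fin M, ∑ j : Fin M, fourier (fun z => f z * fp z) (-(j : ℤ)) *
          (toeplitz M φ)⁻¹ j i * fourier (fun z => fm z * g z) i := by
  have hp0 : ∀ k, k < 0 → fourier fp k = 0 := fun k => fourier_eq_zero_of_neg hb1 h.plus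
  have hp0' : ∀ k, k < 0 → fourier (fun z => (fp z)⁻¹) k = 0 := fun k =>
    fourier_eq_zero_of_neg hb1 h.plus_inv
  have hm0 : ∀ k, 0 < k → fourier fm k = 0 := fun k =>
    fourier_eq_zero_of_pos ha ha1 h.minus h.minus_infty
  have hm0' : ∀ k, 0 < k → fourier (fun z => (fm z)⁻¹) k = 0 := fun k =>
    fourier_eq_zero_of_pos ha ha1 h.minus_inv h.minus_inv_infty
  have hP := h.plus_annulus
  have hP' := h.plus_inv_annulus
  have hQ := h.minus_annulus
  have hQ' := h.minus_inv_annulus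
  have hpn : ∀ z : ℂ, ‖z‖ = 1 → fp z ≠ 0 := fun z hz =>
    h.plus_ne z (mem_ball_zero_iff.2 (by rw [hz]; exact hb1))
  have hmn : ∀ z : ℂ, ‖z‖ = 1 → fm z ≠ 0 := fun z hz => h.minus_ne z (by rw [hz]; exact ha1)
  set U := toeplitzOp fm with hUdef
  set U' := toeplitzOp fun z => (fm z)⁻¹ with hU'def
  set D := toeplitzOp fp with hDdef
  set D' := toeplitzOp fun z => (fp z)⁻¹ with hD'def
  have hUU' : U * U' = 1 := by
    rw [toeplitzOp_mul ha ha1 hb1 hQ hQ' (Or.inl hm0), ← toeplitzOp_one]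
    exact toeplitzOp_congr fun z hz => mul_inv_cancel₀ (hmn z hz)
  have hU'U : U' * U = 1 := by
    rw [toeplitzOp_mul ha ha1 hb1 hQ' hQ (Or.inl hm0'), ← toeplitzOp_one]
    exact toeplitzOp_congr fun z hz => inv_mul_cancel₀ (hmn z hz)
  have hDD' : D * D' = 1 := by
    rw [toeplitzOp_mul ha ha1 hb1 hP hP' (Or.inr hp0'), ← toeplitzOp_one]
    exact toeplitzOp_congr fun z hz => mul_inv_cancel₀ (hpn z hz)
  have hD'D : D' * D = 1 := by
    rw [toeplitzOp_mul ha ha1 hb1 hP' hP (Or.inr hp0), ← toeplitzOp_one]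
    exact toeplitzOp_congr fun z hz => inv_mul_cancel₀ (hpn z hz)
  have hβ : ∀ x, (toeplitzOp fun z => fm z * (fp z)⁻¹) x = U (D' x) := fun x => by
    rw [← toeplitzOp_mul ha ha1 hb1 hQ hP' (Or.inl hm0)]; rfl
  have hβ' : ∀ x, (toeplitzOp fun z => (fm z)⁻¹ * fp z) x = U' (D x) := fun x => by
    rw [← toeplitzOp_mul ha ha1 hb1 hQ' hP (Or.inl hm0')]; rfl
  have hA : ∀ w, headRestrict M (U (D (headExtend M w))) = Matrix.mulVec (toeplitz M φ) w := by
    intro w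
    ext i
    rw [headRestrict_apply, headExtend_apply]
    change evalAt (i : ℕ) ((U * D) _) = _
    rw [map_sum, map_sum, Matrix.mulVec, dotProduct]
    refine Finset.sum_congr rfl fun j _ => ?_
    rw [map_smul, map_smul, evalAt_apply, toeplitzOp_mul ha ha1 hb1 hQ hP (Or.inl hm0),
      toeplitzOp_unitVec (F := fun z => fm z * fp z) ha ha1 hb1 (hQ.mul hP), smul_eq_mul, mul_comm,
      toeplitz, Matrix.of_apply]
    congr 1
    exact fourier_congr (fun z hz => by rw [h.factor z hz, mul_comm]) _
  obtain ⟨hB, hinv⟩ := isUnit_compression_and_inverse (M := M) (G := toeplitzInv M φ)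
    (B := compression M fp fm) hUU' hU'U hDD' hD'D
    (tailRestrict_toeplitzOp_headExtend ha ha1 hb1 hQ hm0)
    (tailRestrict_toeplitzOp_headExtend ha ha1 hb1 hQ' hm0')
    (headRestrict_toeplitzOp_tailExtend ha ha1 hb1 hP hp0)
    (headRestrict_toeplitzOp_tailExtend ha ha1 hb1 hP' hp0')
    (fun w => by
      rw [hA, toeplitzInv_apply, Matrix.mulVec_mulVec, Matrix.mul_nonsing_inv _ hdet,
        Matrix.one_mulVec])
    (fun w => by
      rw [hA, toeplitzInv_apply, Matrix.mulVec_mulVec, Matrix.nonsing_inv_mul _ hdet,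
        Matrix.one_mulVec])
    (fun x => by rw [compression_apply, hβ, hβ'])
  refine ⟨hB, fun f g hf hg => ?_⟩
  rw [hβ', hβ, hinv, map_sub]
  change toeplitzOp f (toeplitzOp g (unitVec 0)) 0 - _ = toeplitzOp f (toeplitzOp g (unitVec 0)) 0 - _
  congr 1
  rw [headExtend_apply, map_sum, map_sum]
  change evalAt 0 _ = _
  rw [map_sum, Finset.sum_comm]
  refine Finset.sum_congr rfl fun j _ => ?_
  rw [map_smul, map_smul, map_smul, evalAt_apply]
  have e1 : toeplitzOp f (D (unitVec (j : ℕ))) 0 = fourier (fun z => f z * fp z) (-(j : ℤ)) := by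
    change (toeplitzOp f * D) (unitVec (j : ℕ)) 0 = _
    rw [toeplitzOp_mul ha ha1 hb1 hf hP (Or.inr hp0),
      toeplitzOp_unitVec (F := fun z => f z * fp z) ha ha1 hb1 (hf.mul hP)]
    simp
  have e2 : ∀ i : Fin M, headRestrict M (U (toeplitzOp g (unitVec 0))) i =
      fourier (fun z => fm z * g z) i := by
    intro i
    change (U * toeplitzOp g) (unitVec 0) (i : ℕ) = _
    rw [toeplitzOp_mul ha ha1 hb1 hQ hg (Or.inl hm0),
      toeplitzOp_unitVec (F := fun z => fm z * g z) ha ha1 hb1 (hQ.mul hg)]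
    simp
  rw [e1, toeplitzInv_apply, Matrix.mulVec, dotProduct, smul_eq_mul, Finset.sum_mul]
  refine Finset.sum_congr rfl fun i _ => ?_
  rw [e2]; ring

/-! ### The contour integral formulas -/

theorem hasMatrix_one_sub_compression {a b : ℝ} (ha : 0 ≤ a) (ha1 : a < 1) (hb1 : 1 < b)
    {L R : ℤ} {φ φp φm : ℤ → ℂ → ℂ}
    (h : Factorization a b (chain φ L R) (chain φp L R) (chain φm L R)) {σ₁ σ₂ : ℝ}
    (h1 : a < σ₁) (h12 : σ₁ < σ₂) (h2 : σ₂ < b) (M : ℕ) :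
    HasMatrix (1 - compression M (chain φp L R) (chain φm L R)) (kernelZero L R φp φm σ₁ σ₂) := by
  intro x j
  refine (hasSum_entry _ x j).congr_fun fun k => ?_
  congr 1
  have hβ := h.minus_annulus.mul h.plus_inv_annulus
  have hβ' := h.minus_inv_annulus.mul h.plus_annulus
  have hK := hasSum_doubleIntegral_inner_large ha ha1 hb1 h1 h12 h2 hβ' hβ (k : ℕ) (-((j : ℕ) + 1))
  have hW := fourier_mul_eq_add ha ha1 hb1 hβ hβ' (j : ℕ) (k : ℕ) (hK.congr_fun fun l => by
    rw [mul_comm]; congr 2 <;> ring)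
  have hone : fourier (fun z => ((chain φm L R * fun z => (chain φp L R z)⁻¹) z) *
      (((fun z => (chain φm L R z)⁻¹) * chain φp L R) z)) ((j : ℕ) - (k : ℕ)) =
      if (j : ℕ) = (k : ℕ) then 1 else 0 := by
    rw [fourier_congr (G := fun _ => 1), fourier_one]
    · congr 1
      simp only [eq_iff_iff]
      omega
    · intro z hz
      have e1 := h.plus_ne z (mem_ball_zero_iff.2 (by rw [hz]; exact hb1))
      have e2 := h.minus_ne z (by rw [hz]; exact ha1)
      simp only [Pi.mul_apply]
      field_simp
  rw [hone] at hW
  change _ = unitVec k j - compression M _ _ (unitVec k) j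
  rw [compression_apply, tailRestrict_apply, tailExtend_unitVec, unitVec_apply]
  have e3 : (if j = k then (1 : ℂ) else 0) = if (j : ℕ) = (k : ℕ) then 1 else 0 := by
    simp only [Subtype.ext_iff]
  rw [e3, hW]
  refine Eq.trans ?_ (add_sub_cancel_left _ _).symm
  rw [kernelZero]
  congr 1
  refine circleIntegral.integral_congr (ha.trans h1.le) fun ω _ => ?_
  refine circleIntegral.integral_congr (ha.trans (h1.trans h12).le) fun ζ _ => ?_
  simp only [Pi.mul_apply, zpow_neg]
  norm_cast
  simp only [div_eq_mul_inv, mul_inv]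
  ring

/-- The symbol `z ^ (u-d+1) φ⁻_{r,R}(z) / φ⁺_{L,r}(z)` of the row that belongs to the site
`(r,u)`. -/
def rowSymbol (L R d : ℤ) (φp φm : ℤ → ℂ → ℂ) (r u : ℤ) (z : ℂ) : ℂ :=
  z ^ (u - d + 1) * (chain φm r R z * (chain φp L r z)⁻¹)

/-- The symbol `z ^ (d-v-1) φ⁺_{L,s}(z) / φ⁻_{s,R}(z)` of the column that belongs to the site
`(s,v)`. -/
def colSymbol (L R d : ℤ) (φp φm : ℤ → ℂ → ℂ) (s v : ℤ) (z : ℂ) : ℂ :=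
  z ^ (d - v - 1) * (chain φp L s z * (chain φm s R z)⁻¹)

theorem differentiableOn_rowSymbol {a b : ℝ} {L R d : ℤ} {φ φp φm : ℤ → ℂ → ℂ}
    (ha : 0 ≤ a)
    (h : ∀ q, L ≤ q → q < R → Factorization a b (φ q) (φp q) (φm q)) {r : ℤ} (hLr : L ≤ r)
    (hrR : r ≤ R) (u : ℤ) :
    DifferentiableOn ℂ (rowSymbol L R d φp φm r u) (annulus a b) := by
  refine differentiableOn_zpow_mul ha (DifferentiableOn.mul ?_ ?_) _
  · exact (Factorization.chain fun q hq hq' => h q (hLr.trans hq) hq').minus_annulus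
  · exact (Factorization.chain fun q hq hq' => h q hq (hq'.trans_le hrR)).plus_inv_annulus

theorem differentiableOn_colSymbol {a b : ℝ} {L R d : ℤ} {φ φp φm : ℤ → ℂ → ℂ}
    (ha : 0 ≤ a)
    (h : ∀ q, L ≤ q → q < R → Factorization a b (φ q) (φp q) (φm q)) {s : ℤ} (hLs : L ≤ s)
    (hsR : s ≤ R) (v : ℤ) :
    DifferentiableOn ℂ (colSymbol L R d φp φm s v) (annulus a b) := by
  refine differentiableOn_zpow_mul ha (DifferentiableOn.mul ?_ ?_) _
  · exact (Factorization.chain fun q hq hq' => h q hq (hq'.trans_le hsR)).plus_annulus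
  · exact (Factorization.chain fun q hq hq' => h q (hLs.trans hq) hq').minus_inv_annulus

theorem fourier_rowSymbol_mul {a b : ℝ} {L R d : ℤ} {φ φp φm : ℤ → ℂ → ℂ}
    (hb1 : 1 < b)
    (h : ∀ q, L ≤ q → q < R → Factorization a b (φ q) (φp q) (φm q)) {r : ℤ} (hLr : L ≤ r)
    (hrR : r ≤ R) (u k : ℤ) :
    fourier (fun z => rowSymbol L R d φp φm r u z * chain φp L R z) k =
      fourier (chain φ r R) (k - (u - d + 1)) := by
  rw [← fourier_zpow_mul]
  refine fourier_congr (fun z hz => ?_) k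
  have hne := (Factorization.chain fun q hq hq' => h q hq (hq'.trans_le hrR)).plus_ne z
    (mem_ball_zero_iff.2 (by rw [hz]; exact hb1))
  rw [rowSymbol, ← chain_mul_chain φp hLr hrR,
    (Factorization.chain fun q hq hq' => h q (hLr.trans hq) hq').factor z hz]
  field_simp

theorem fourier_mul_colSymbol {a b : ℝ} {L R d : ℤ} {φ φp φm : ℤ → ℂ → ℂ}
    (ha1 : a < 1)
    (h : ∀ q, L ≤ q → q < R → Factorization a b (φ q) (φp q) (φm q)) {s : ℤ} (hLs : L ≤ s)
    (hsR : s ≤ R) (v k : ℤ) :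
    fourier (fun z => chain φm L R z * colSymbol L R d φp φm s v z) k =
      fourier (chain φ L s) (k - (d - v - 1)) := by
  rw [← fourier_zpow_mul]
  refine fourier_congr (fun z hz => ?_) k
  have hne := (Factorization.chain fun q hq hq' => h q (hLs.trans hq) hq').minus_ne z
    (by rw [hz]; exact ha1)
  rw [colSymbol, ← chain_mul_chain φm hLs hsR,
    (Factorization.chain fun q hq hq' => h q hq (hq'.trans_le hsR)).factor z hz]
  field_simp

theorem hasSum_mainKernel {a b : ℝ} {L R d : ℤ} {φ φp φm : ℤ → ℂ → ℂ}
    (ha : 0 ≤ a) (ha1 : a < 1) (hb1 : 1 < b)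
    (h : ∀ q, L ≤ q → q < R → Factorization a b (φ q) (φp q) (φm q)) {ρ₁ ρ₂ : ℝ} (h1 : a < ρ₁)
    (h12 : ρ₁ < ρ₂) (h2 : ρ₂ < b) {r s : ℤ} (hLr : L ≤ r) (hrR : r ≤ R) (hLs : L ≤ s)
    (hsR : s ≤ R) (u v : ℤ) :
    HasSum (fun l : ℕ => fourier (rowSymbol L R d φp φm r u) (-(l : ℤ)) *
      fourier (colSymbol L R d φp φm s v) l) (mainKernel L R d φp φm ρ₁ ρ₂ r u s v) := by
  have hK := hasSum_doubleIntegral_inner_large ha ha1 hb1 h1 h12 h2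
    (differentiableOn_rowSymbol (d := d) ha h hLr hrR u)
    (differentiableOn_colSymbol (d := d) ha h hLs hsR v) (-1) 0
  convert! hK using 1
  · ext l; congr 2; all_goals ring
  · rw [mainKernel]
    congr 1
    refine circleIntegral.integral_congr (ha.trans h1.le) fun z hz => ?_
    refine circleIntegral.integral_congr (ha.trans (h1.trans h12).le) fun w hw => ?_
    have hz0 : z ≠ 0 := norm_pos_iff.1 (mem_sphere_zero_iff_norm.1 hz ▸ ha.trans_lt h1)
    simp only [rowSymbol, colSymbol]
    rw [show d - v - 1 = -(v - d + 1) by ring, zpow_neg w, zpow_add_one₀ hz0, zpow_neg_one, zpow_zero]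
    field_simp

theorem hasSum_mainKernelStar {a b : ℝ} {L R d : ℤ} {φ φp φm : ℤ → ℂ → ℂ}
    (ha : 0 ≤ a) (ha1 : a < 1) (hb1 : 1 < b)
    (h : ∀ q, L ≤ q → q < R → Factorization a b (φ q) (φp q) (φm q)) {ρ₁ ρ₃ : ℝ} (h3 : a < ρ₃)
    (h31 : ρ₃ < ρ₁) (h1 : ρ₁ < b) {r s : ℤ} (hLr : L ≤ r) (hrR : r ≤ R) (hLs : L ≤ s)
    (hsR : s ≤ R) (u v : ℤ) :
    HasSum (fun l : ℕ => fourier (rowSymbol L R d φp φm r u) (l + 1) *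
      fourier (colSymbol L R d φp φm s v) (-(l : ℤ) - 1))
      (mainKernelStar L R d φp φm ρ₁ ρ₃ r u s v) := by
  have hK := hasSum_doubleIntegral_inner_small ha ha1 hb1 h3 h31 h1
    (differentiableOn_colSymbol (d := d) ha h hLs hsR v)
    (differentiableOn_rowSymbol (d := d) ha h hLr hrR u) 0 (-1)
  convert! hK using 1
  · ext l; rw [mul_comm]; congr 2; ring
  · rw [mainKernelStar]
    congr 1
    refine circleIntegral.integral_congr (ha.trans (h3.trans h31).le) fun z hz => ?_
    refine circleIntegral.integral_congr (ha.trans h3.le) fun w hw => ?_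
    have hz0 : z ≠ 0 :=
      norm_pos_iff.1 (mem_sphere_zero_iff_norm.1 hz ▸ ha.trans_lt (h3.trans h31))
    simp only [rowSymbol, colSymbol]
    rw [show d - v - 1 = -(v - d + 1) by ring, zpow_neg w, zpow_add_one₀ hz0, zpow_neg_one, zpow_zero]
    field_simp

theorem aCoeff_eq {a b : ℝ} {L R d : ℤ} {φ φp φm : ℤ → ℂ → ℂ}
    (ha : 0 ≤ a) (ha1 : a < 1) (hb1 : 1 < b)
    (h : ∀ q, L ≤ q → q < R → Factorization a b (φ q) (φp q) (φm q)) {ρ₂ σ₂ : ℝ} (h1 : a < σ₂)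
    (h12 : σ₂ < ρ₂) (h2 : ρ₂ < b) {s : ℤ} (hLs : L ≤ s) (hsR : s ≤ R) (v : ℤ) (j : ℕ) :
    aCoeff L R d φp φm ρ₂ σ₂ s v j =
      -(toeplitzOp (fun z => chain φm L R z * (chain φp L R z)⁻¹)
        (toeplitzOp (colSymbol L R d φp φm s v) (unitVec 0))) j := by
  have hLR : Factorization a b (chain φ L R) (chain φp L R) (chain φm L R) := Factorization.chain h
  have hβ := hLR.minus_annulus.mul hLR.plus_inv_annulus
  have hg := differentiableOn_colSymbol (d := d) ha h hLs hsR v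
  have hK := hasSum_doubleIntegral_inner_small ha ha1 hb1 h1 h12 h2 hβ hg (-((j : ℤ) + 1)) 0
  have hS := hasSum_toeplitzOp_mul ha ha1 hb1 hβ hg j 0
  have e := hK.unique (hS.congr_fun fun l => by congr 2 <;> simp)
  change _ = -((toeplitzOp (chain φm L R * fun z => (chain φp L R z)⁻¹) *
    toeplitzOp (colSymbol L R d φp φm s v)) (unitVec 0)) j
  rw [← e, aCoeff, ← mul_neg]
  congr 1
  rw [← neg_one_mul, ← circleIntegral.integral_const_mul]
  refine circleIntegral.integral_congr (ha.trans (h1.trans h12).le) fun w hw => ?_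
  simp only
  rw [← circleIntegral.integral_const_mul]
  refine circleIntegral.integral_congr (ha.trans h1.le) fun ζ hζ => ?_
  simp only [Pi.mul_apply, colSymbol, zpow_neg, zpow_zero]
  rw [← neg_sub w ζ, ← Nat.cast_succ, zpow_natCast]
  simp only [div_eq_mul_inv, mul_inv, inv_neg, Nat.succ_eq_add_one, pow_succ]
  ring

theorem bCoeff_eq {a b : ℝ} {L R d : ℤ} {φ φp φm : ℤ → ℂ → ℂ}
    (ha : 0 ≤ a) (ha1 : a < 1) (hb1 : 1 < b)
    (h : ∀ q, L ≤ q → q < R → Factorization a b (φ q) (φp q) (φm q)) {ρ₁ σ₁ : ℝ} (h1 : a < ρ₁)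
    (h12 : ρ₁ < σ₁) (h2 : σ₁ < b) {r : ℤ} (hLr : L ≤ r) (hrR : r ≤ R) (u : ℤ) (k : ℕ) :
    bCoeff L R d φp φm ρ₁ σ₁ r u k =
      (toeplitzOp (rowSymbol L R d φp φm r u)
        (toeplitzOp (fun z => (chain φm L R z)⁻¹ * chain φp L R z) (unitVec k))) 0 := by
  have hLR : Factorization a b (chain φ L R) (chain φp L R) (chain φm L R) := Factorization.chain h
  have hβ' := hLR.minus_inv_annulus.mul hLR.plus_annulus
  have hf := differentiableOn_rowSymbol (d := d) ha h hLr hrR u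
  have hK := hasSum_doubleIntegral_inner_large ha ha1 hb1 h1 h12 h2 hf hβ' (-1) k
  have hS := hasSum_toeplitzOp_mul ha ha1 hb1 hf hβ' 0 k
  have e := hK.unique (hS.congr_fun fun l => by congr 2)
  change _ = ((toeplitzOp (rowSymbol L R d φp φm r u) *
    toeplitzOp ((fun z => (chain φm L R z)⁻¹) * chain φp L R)) (unitVec k)) 0
  rw [← e, bCoeff]
  congr 1
  refine circleIntegral.integral_congr (ha.trans h1.le) fun z hz => ?_
  refine circleIntegral.integral_congr (ha.trans (h1.trans h12).le) fun ω hω => ?_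
  have hz0 : z ≠ 0 := norm_pos_iff.1 (mem_sphere_zero_iff_norm.1 hz ▸ ha.trans_lt h1)
  simp only [Pi.mul_apply, rowSymbol]
  rw [show d - u = -(u - d) by ring, zpow_neg z (u - d), zpow_add_one₀ hz0, zpow_neg_one, zpow_natCast]
  field_simp

/-- The two contour integrals differ by the residue at `w = z`. -/
theorem mainKernel_add_mainKernelStar {a b : ℝ} {L R d : ℤ} {φ φp φm : ℤ → ℂ → ℂ}
    (ha : 0 ≤ a) (ha1 : a < 1) (hb1 : 1 < b)
    (h : ∀ q, L ≤ q → q < R → Factorization a b (φ q) (φp q) (φm q)) {ρ₁ ρ₂ ρ₃ : ℝ} (h3 : a < ρ₃)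
    (h31 : ρ₃ < ρ₁) (h12 : ρ₁ < ρ₂) (h2 : ρ₂ < b) {r s : ℤ} (hLr : L ≤ r) (hrR : r ≤ R)
    (hLs : L ≤ s) (hsR : s ≤ R) (u v : ℤ) :
    mainKernel L R d φp φm ρ₁ ρ₂ r u s v + mainKernelStar L R d φp φm ρ₁ ρ₃ r u s v =
      (if r = s ∧ u = v then 1 else 0) + transition φ r s u v +
      (if s < r then fourier (fun z => z ^ (u - v) / chain φ s r z) 0 else 0) := by
  have hf := differentiableOn_rowSymbol (d := d) ha h hLr hrR u
  have hg := differentiableOn_colSymbol (d := d) ha h hLs hsR v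
  have hsum := hasSum_fourier_mul_shift ha ha1 hb1 hf hg 0 0
  have hM := hasSum_mainKernel (d := d) ha ha1 hb1 h (h3.trans h31) h12 h2 hLr hrR hLs hsR u v
  have hM' := hasSum_mainKernelStar (d := d) ha ha1 hb1 h h3 h31 (h12.trans h2) hLr hrR hLs hsR u v
  have e := (HasSum.of_nat_of_neg_add_one (f := fun l : ℤ =>
    fourier (rowSymbol L R d φp φm r u) (0 - l) * fourier (colSymbol L R d φp φm s v) (l - 0))
    (hM.congr_fun fun l => by congr 2; all_goals ring)
    (hM'.congr_fun fun l => by congr 2 <;> ring)).unique hsum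
  rw [e, sub_zero, transition]
  have hval : ∀ z : ℂ, ‖z‖ = 1 → rowSymbol L R d φp φm r u z * colSymbol L R d φp φm s v z =
      z ^ (u - v) * ((chain φm r R z * (chain φm s R z)⁻¹) *
        (chain φp L s z * (chain φp L r z)⁻¹)) := by
    intro z hz
    have hz0 : z ≠ 0 := norm_pos_iff.1 (hz ▸ one_pos)
    rw [rowSymbol, colSymbol, show u - v = (u - d + 1) + (d - v - 1) by ring,
      zpow_add₀ hz0 (u - d + 1) (d - v - 1)]
    ring
  have hpne : ∀ (t : ℤ) (z : ℂ), t ≤ R → ‖z‖ = 1 → chain φp L t z ≠ 0 := fun t z ht hz =>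
    (Factorization.chain fun q hq hq' => h q hq (hq'.trans_le ht)).plus_ne z
      (mem_ball_zero_iff.2 (by rw [hz]; exact hb1))
  have hmne : ∀ (t : ℤ) (z : ℂ), L ≤ t → ‖z‖ = 1 → chain φm t R z ≠ 0 := fun t z ht hz =>
    (Factorization.chain fun q hq hq' => h q (ht.trans hq) hq').minus_ne z
      (by rw [hz]; exact ha1)
  rcases lt_trichotomy r s with hrs | hrs | hrs
  · rw [if_neg (by omega), if_pos hrs, if_neg (by omega), zero_add, add_zero,
      show v - u = 0 - (u - v) by ring, ← fourier_zpow_mul]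
    refine fourier_congr (fun z hz => ?_) 0
    rw [hval z hz, (Factorization.chain fun q hq hq' =>
      h q (hLr.trans hq) (hq'.trans_le hsR)).factor z hz, ← chain_mul_chain φm hrs.le hsR,
      ← chain_mul_chain φp hLr hrs.le]
    have := hpne r z hrR hz
    have := hmne s z hLs hz
    field_simp
  · subst hrs
    rw [if_neg (lt_irrefl r), if_neg (lt_irrefl r), add_zero, add_zero]
    rw [fourier_congr (G := fun z => z ^ (u - v) * 1), fourier_zpow_mul (fun _ => 1), fourier_one]
    · congr 1
      simp only [eq_iff_iff, true_and]
      omega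
    · intro z hz
      rw [hval z hz]
      have := hpne r z hrR hz
      have := hmne r z hLr hz
      field_simp
  · rw [if_neg (by omega), if_neg (by omega), if_pos hrs, add_zero, zero_add]
    refine fourier_congr (fun z hz => ?_) 0
    have hc := Factorization.chain fun q hq hq' => h q (hLs.trans hq) (hq'.trans_le hrR)
    have e1 := hc.plus_ne z (mem_ball_zero_iff.2 (by rw [hz]; exact hb1))
    have e2 := hc.minus_ne z (by rw [hz]; exact ha1)
    rw [hval z hz, hc.factor z hz, ← chain_mul_chain φm hrs.le hrR,
      ← chain_mul_chain φp hLs hrs.le]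
    have := hpne s z hsR hz
    have := hmne r z hLr hz
    field_simp

/-- The Borodin–Okounkov formulas for the kernel and its dual. -/
theorem exists_correction {a b : ℝ} {L R d : ℤ} {φ φp φm : ℤ → ℂ → ℂ}
    (ha : 0 ≤ a) (ha1 : a < 1) (hb1 : 1 < b)
    (h : ∀ q, L ≤ q → q < R → Factorization a b (φ q) (φp q) (φm q)) {M : ℕ}
    (hdet : IsUnit (toeplitz M (chain φ L R)).det) {ρ₁ ρ₂ ρ₃ σ₁ σ₂ : ℝ} (h3 : a < ρ₃)
    (h31 : ρ₃ < ρ₁) (hρσ : ρ₁ < σ₁) (hσ : σ₁ < σ₂) (hσρ : σ₂ < ρ₂) (h2 : ρ₂ < b) {r s : ℤ}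
    (hLr : L ≤ r) (hrR : r ≤ R) (hLs : L ≤ s) (hsR : s ≤ R) (u v : ℤ) :
    ∃ (x : TailSpace M) (correction : ℂ),
      (∀ k : Set.Ici M, x k = aCoeff L R d φp φm ρ₂ σ₂ s v k) ∧
      HasSum (fun k : Set.Ici M =>
        (Ring.inverse (compression M (chain φp L R) (chain φm L R)) x) k *
          bCoeff L R d φp φm ρ₁ σ₁ r u k) correction ∧
      pathKernel L R M d φ r u s v = -transition φ r s u v +
        mainKernel L R d φp φm ρ₁ ρ₂ r u s v + correction ∧
      dualPathKernel L R M d φ r u s v =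
        -(if s < r then fourier (fun z => z ^ (u - v) / chain φ s r z) 0 else 0) +
        mainKernelStar L R d φp φm ρ₁ ρ₃ r u s v - correction := by
  have hLR : Factorization a b (chain φ L R) (chain φp L R) (chain φm L R) := Factorization.chain h
  have h1 := h3.trans h31
  have h12 := hρσ.trans (hσ.trans hσρ)
  have hf := differentiableOn_rowSymbol (d := d) ha h hLr hrR u
  have hg := differentiableOn_colSymbol (d := d) ha h hLs hsR v
  have hbo := (borodin_okounkov ha ha1 hb1 hLR hdet).2 _ _ hf hg
  let y : TailSpace M →L[ℂ] ℂ := (evalAt 0).comp ((toeplitzOp (rowSymbol L R d φp φm r u)).comp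
    ((toeplitzOp fun z => (chain φm L R z)⁻¹ * chain φp L R z).comp (tailExtend M)))
  let x : TailSpace M := tailRestrict M (toeplitzOp (fun z => chain φm L R z * (chain φp L R z)⁻¹)
        (toeplitzOp (colSymbol L R d φp φm s v) (unitVec 0)))
  have hM := (hasSum_mainKernel (d := d) ha ha1 hb1 h h1 h12 h2 hLr hrR hLs hsR u v).unique
    ((hasSum_toeplitzOp_mul ha ha1 hb1 hf hg 0 0).congr_fun fun l => by congr 2 <;> simp)
  have hK : pathKernel L R M d φ r u s v = -transition φ r s u v +
        mainKernel L R d φp φm ρ₁ ρ₂ r u s v +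
        y (Ring.inverse (compression M (chain φp L R) (chain φm L R)) (-x)) := by
    have hy : y (Ring.inverse (compression M (chain φp L R) (chain φm L R)) (-x)) =
        -y (Ring.inverse (compression M (chain φp L R) (chain φm L R)) x) := by
      rw [map_neg, map_neg]
    rw [hy, show y (Ring.inverse (compression M (chain φp L R) (chain φm L R)) x) = _ from hbo, hM,
      pathKernel, add_assoc]
    congr 1
    rw [neg_sub, add_sub_cancel]
    refine Finset.sum_congr rfl fun i _ => Finset.sum_congr rfl fun j _ => ?_
    rw [fourier_rowSymbol_mul hb1 h hLr hrR, fourier_mul_colSymbol ha1 h hLs hsR]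
    rw [show (-(j : ℤ) - (u - d + 1)) = d - (j + 1) - u by ring,
      show ((i : ℤ) - (d - v - 1)) = v + (i + 1) - d by ring]
  refine ⟨-x, _, fun k => ?_, ?_, hK, ?_⟩
  · rw [aCoeff_eq ha ha1 hb1 h (h1.trans (hρσ.trans hσ)) hσρ h2 hLs hsR]
    rfl
  · refine (hasSum_functional y _).congr_fun fun k => ?_
    congr 1
    rw [bCoeff_eq ha ha1 hb1 h h1 hρσ (hσ.trans (hσρ.trans h2)) hLr hrR]
    change toeplitzOp _ _ 0 = toeplitzOp _ (toeplitzOp _ (tailExtend M (unitVec k))) 0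
    rw [tailExtend_unitVec]
  · have hMM := mainKernel_add_mainKernelStar (d := d) ha ha1 hb1 h h3 h31 h12 h2 hLr hrR hLs hsR u v
    rw [dualPathKernel, hK]
    linear_combination -hMM

/-! ### Andréief's identity and sums over path configurations -/

theorem summable_norm_and_hasSum_prod_pi {α : Type*} {M : ℕ} (f : Fin M → α → ℂ)
    (hf : ∀ k, Summable fun y => ‖f k y‖) :
    (Summable fun y : Fin M → α => ‖∏ k, f k (y k)‖) ∧
      HasSum (fun y : Fin M → α => ∏ k, f k (y k)) (∏ k, ∑' y, f k y) := by
  induction M with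
  | zero => exact ⟨.of_finite, by simp⟩
  | succ M ih =>
    obtain ⟨h1, h2⟩ := ih (fun k => f k.succ) fun k => hf k.succ
    have e : ∀ p : α × (Fin M → α), ∏ k, f k (Fin.consEquiv (fun _ => α) p k) =
        f 0 p.1 * ∏ k, f k.succ (p.2 k) := fun p => by
      rw [Fin.prod_univ_succ]; rfl
    have hs := Summable.mul_norm (hf 0) h1
    constructor
    · rw [← (Fin.consEquiv fun _ => α).summable_iff]
      exact hs.congr fun p => by rw [Function.comp, e]
    · rw [← (Fin.consEquiv fun _ => α).hasSum_iff, Fin.prod_univ_succ]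
      exact ((hf 0).of_norm.hasSum.mul h2 hs.of_norm).congr_fun fun p => by
        rw [Function.comp, e]

/-- Andréief's identity (the Cauchy–Binet formula for sums over all `M`-tuples). -/
theorem hasSum_det_mul_det {α : Type*} {M : ℕ} (a b : Fin M → α → ℂ)
    (h : ∀ i j, Summable fun y => a i y * b j y) :
    HasSum (fun y : Fin M → α => Matrix.det (Matrix.of fun i k => a i (y k)) *
        Matrix.det (Matrix.of fun k j => b j (y k)))
      ((M.factorial : ℂ) * Matrix.det (Matrix.of fun i j => ∑' y, a i y * b j y)) := by
  have key : HasSum (fun y : Fin M → α => ∑ σ : Equiv.Perm (Fin M), ∑ τ : Equiv.Perm (Fin M),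
      ((Equiv.Perm.sign σ : ℤ) : ℂ) * ((Equiv.Perm.sign τ : ℤ) : ℂ) *
        ∏ k, a (σ k) (y k) * b (τ k) (y k))
      (∑ σ : Equiv.Perm (Fin M), ∑ τ : Equiv.Perm (Fin M),
      ((Equiv.Perm.sign σ : ℤ) : ℂ) * ((Equiv.Perm.sign τ : ℤ) : ℂ) *
        ∏ k, ∑' y, a (σ k) y * b (τ k) y) :=
    hasSum_sum fun σ _ => hasSum_sum fun τ _ =>
      (summable_norm_and_hasSum_prod_pi (fun k y => a (σ k) y * b (τ k) y)
        fun k => (h _ _).norm).2.mul_left _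
  convert! key using 1
  · ext y
    rw [← Matrix.det_transpose (Matrix.of fun k j => b j (y k)), Matrix.det_apply', Matrix.det_apply',
      Finset.sum_mul_sum]
    refine Finset.sum_congr rfl fun σ _ => Finset.sum_congr rfl fun τ _ => ?_
    simp only [Matrix.of_apply, Matrix.transpose_apply, Finset.prod_mul_distrib]
    ring
  · have e : ∀ σ : Equiv.Perm (Fin M), ∑ τ : Equiv.Perm (Fin M),
        ((Equiv.Perm.sign σ : ℤ) : ℂ) * ((Equiv.Perm.sign τ : ℤ) : ℂ) *
          ∏ k, ∑' y, a (σ k) y * b (τ k) y =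
        Matrix.det (Matrix.of fun i j => ∑' y, a i y * b j y) := by
      intro σ
      rw [← Matrix.det_transpose, Matrix.det_apply',
        ← Equiv.sum_comp (Equiv.mulRight σ) fun τ : Equiv.Perm (Fin M) =>
          ((Equiv.Perm.sign σ : ℤ) : ℂ) * ((Equiv.Perm.sign τ : ℤ) : ℂ) *
          ∏ k, ∑' y, a (σ k) y * b (τ k) y]
      refine Finset.sum_congr rfl fun τ _ => ?_
      simp only [Equiv.coe_mulRight, Equiv.Perm.sign_mul, Equiv.Perm.mul_apply, Matrix.transpose_apply,
        Matrix.of_apply]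
      rw [Equiv.prod_comp σ fun k => ∑' y, a k y * b (τ k) y]
      rcases Int.units_eq_one_or (Equiv.Perm.sign σ) with hs | hs <;> simp [hs]
    simp only [e, Finset.sum_const, Finset.card_univ, Fintype.card_perm, Fintype.card_fin,
      nsmul_eq_mul]

/-- A configuration on the levels `L+1, …, R-1` consists of the positions at the first of these
levels and a configuration on the others. -/
def consConfig {L R : ℤ} {M : ℕ} (hLR : L + 1 < R) :
    Config (L + 1) R M × (Fin M → ℤ) ≃ Config L R M where
  toFun p r := if h : (r : ℤ) = L + 1 then p.2 else
    p.1 ⟨r, lt_of_le_of_ne (by have := r.2.1; omega) (Ne.symm h), r.2.2⟩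
  invFun x := (fun r => x ⟨r, (lt_add_one L).trans r.2.1, r.2.2⟩, x ⟨L + 1, lt_add_one L, hLR⟩)
  left_inv p := by
    refine Prod.ext ?_ ?_
    · funext r
      have := r.2.1
      simp only
      rw [dif_neg (by omega)]
    · simp
  right_inv x := by
    funext r
    simp only
    split_ifs with h
    · congr 1
      exact Subtype.ext h.symm
    · rfl

theorem position_consConfig_of_gt {L R : ℤ} {M : ℕ} (hLR : L + 1 < R) (d : ℤ)
    (p : Config (L + 1) R M × (Fin M → ℤ)) {r : ℤ} (hr : L + 1 < r) (j : Fin M) :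
    position d (consConfig hLR p) r j = position d p.1 r j := by
  unfold position
  by_cases h : r < R
  · rw [dif_pos ⟨by omega, h⟩, dif_pos ⟨hr, h⟩]
    simp only [consConfig, Equiv.coe_fn_mk]
    rw [dif_neg (by omega)]
  · rw [dif_neg fun h' => h h'.2, dif_neg fun h' => h h'.2]

theorem position_consConfig_self {L R : ℤ} {M : ℕ} (hLR : L + 1 < R) (d : ℤ)
    (p : Config (L + 1) R M × (Fin M → ℤ)) (j : Fin M) :
    position d (consConfig hLR p) (L + 1) j = p.2 j := by
  unfold position
  rw [dif_pos ⟨by omega, hLR⟩]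
  simp [consConfig]

/-- The sum over all configurations of a product of determinants along the levels, with a weight
`H r v` for each particle. The family `g` propagates the initial functions from level to level;
each level contributes one application of Andréief's identity. -/
theorem tsum_det_mul_prod {M : ℕ} {d : ℤ} {φ : ℤ → ℂ → ℂ} {H : ℤ → ℤ → ℂ} {R : ℤ}
    {g : ℤ → Fin M → ℤ → ℂ} (n : ℕ) : ∀ {L : ℤ}, R = L + 1 + n →
    (∀ s, L < s → s < R → ∀ i z,
      HasSum (fun y => g s i y * H s y * fourier (φ s) (z - y)) (g (s + 1) i z)) →
    (Summable fun x : Config L R M =>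
      Matrix.det (Matrix.of fun i k => g (L + 1) i (position d x (L + 1) k)) *
        ∏ r ∈ Finset.Ioo L R, ((∏ j, H r (position d x r j)) * Matrix.det (Matrix.of fun j k =>
          fourier (φ r) (position d x (r + 1) k - position d x r j)))) →
    ∑' x : Config L R M,
      Matrix.det (Matrix.of fun i k => g (L + 1) i (position d x (L + 1) k)) *
        ∏ r ∈ Finset.Ioo L R, ((∏ j, H r (position d x r j)) * Matrix.det (Matrix.of fun j k =>
          fourier (φ r) (position d x (r + 1) k - position d x r j))) =
      (M.factorial : ℂ) ^ n *
        Matrix.det (Matrix.of fun i k : Fin M => g R i (d - ((k : ℤ) + 1))) := by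
  induction n with
  | zero =>
    intro L hR _ _
    obtain rfl : R = L + 1 := by simpa using hR
    have he : IsEmpty (Set.Ioo L (L + 1)) := ⟨fun r => by have := r.2.1; have := r.2.2; omega⟩
    have hI : Finset.Ioo L (L + 1) = ∅ := by
      ext r; simp only [Finset.mem_Ioo, Finset.notMem_empty, iff_false]; omega
    rw [tsum_eq_single (fun r => he.elim r) fun x hx => absurd (Subsingleton.elim _ _) hx, hI]
    simp [position]
  | succ n ih =>
    intro L hR hg hs
    have hLR : L + 1 < R := by push_cast at hR; omega
    have hI : Finset.Ioo L R = insert (L + 1) (Finset.Ioo (L + 1) R) := by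
      ext r; simp only [Finset.mem_Ioo, Finset.mem_insert]; omega
    have hterm : ∀ p : Config (L + 1) R M × (Fin M → ℤ),
        Matrix.det (Matrix.of fun i k =>
          g (L + 1) i (position d (consConfig hLR p) (L + 1) k)) *
        ∏ r ∈ Finset.Ioo L R, ((∏ j, H r (position d (consConfig hLR p) r j)) *
          Matrix.det (Matrix.of fun j k => fourier (φ r) (position d (consConfig hLR p) (r + 1) k -
            position d (consConfig hLR p) r j))) =
        (Matrix.det (Matrix.of fun i k => g (L + 1) i (p.2 k) * H (L + 1) (p.2 k)) *
          Matrix.det (Matrix.of fun j k =>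
            fourier (φ (L + 1)) (position d p.1 (L + 1 + 1) k - p.2 j))) *
        ∏ r ∈ Finset.Ioo (L + 1) R, ((∏ j, H r (position d p.1 r j)) *
          Matrix.det (Matrix.of fun j k => fourier (φ r) (position d p.1 (r + 1) k -
            position d p.1 r j))) := by
      intro p
      rw [hI, Finset.prod_insert (by simp)]
      have hprod : ∏ r ∈ Finset.Ioo (L + 1) R, ((∏ j, H r (position d (consConfig hLR p) r j)) *
          Matrix.det (Matrix.of fun j k => fourier (φ r) (position d (consConfig hLR p) (r + 1) k -
            position d (consConfig hLR p) r j))) =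
          ∏ r ∈ Finset.Ioo (L + 1) R, ((∏ j, H r (position d p.1 r j)) *
          Matrix.det (Matrix.of fun j k => fourier (φ r) (position d p.1 (r + 1) k -
            position d p.1 r j))) := by
        refine Finset.prod_congr rfl fun r hr => ?_
        have hr1 := (Finset.mem_Ioo.1 hr).1
        simp only [position_consConfig_of_gt hLR d p hr1,
          position_consConfig_of_gt hLR d p (hr1.trans (lt_add_one r))]
      rw [hprod]
      simp only [position_consConfig_self, position_consConfig_of_gt hLR d p (lt_add_one (L + 1))]
      have hrow := Matrix.det_mul_row (fun k => H (L + 1) (p.2 k))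
        (Matrix.of fun i k => g (L + 1) i (p.2 k))
      simp only [Matrix.of_apply, mul_comm (H _ _)] at hrow
      rw [hrow]
      ring
    have hs' := (consConfig (M := M) hLR).summable_iff.2 hs
    rw [Function.comp_def] at hs'
    simp only [hterm] at hs'
    have hfib : ∀ x : Config (L + 1) R M, ∑' y : Fin M → ℤ,
        (Matrix.det (Matrix.of fun i k => g (L + 1) i (y k) * H (L + 1) (y k)) *
          Matrix.det (Matrix.of fun j k =>
            fourier (φ (L + 1)) (position d x (L + 1 + 1) k - y j))) *
        ∏ r ∈ Finset.Ioo (L + 1) R, ((∏ j, H r (position d x r j)) *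
          Matrix.det (Matrix.of fun j k => fourier (φ r) (position d x (r + 1) k -
            position d x r j))) =
        (M.factorial : ℂ) *
        (Matrix.det (Matrix.of fun i k => g (L + 1 + 1) i (position d x (L + 1 + 1) k)) *
        ∏ r ∈ Finset.Ioo (L + 1) R, ((∏ j, H r (position d x r j)) *
          Matrix.det (Matrix.of fun j k => fourier (φ r) (position d x (r + 1) k -
            position d x r j)))) := by
      intro x
      rw [tsum_mul_right]
      have hA := hasSum_det_mul_det (fun i y => g (L + 1) i y * H (L + 1) y)
        (fun k y => fourier (φ (L + 1)) (position d x (L + 1 + 1) k - y))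
        fun i k => (hg (L + 1) (lt_add_one L) hLR i _).summable
      rw [hA.tsum_eq, mul_assoc]
      congr 4
      ext i k
      exact (hg (L + 1) (lt_add_one L) hLR i _).tsum_eq
    rw [← (consConfig hLR).tsum_eq]
    simp only [hterm]
    rw [hs'.tsum_prod]
    have hs2 := hs'.prod
    simp only [hfib] at hs2 ⊢
    rw [tsum_mul_left, ih (by push_cast at hR; omega) (fun s hs => hg s (by omega))
      ((summable_mul_left_iff (by exact_mod_cast M.factorial_ne_zero)).1 hs2), pow_succ]
    ring

/-! ### Absolute convergence of the partition function -/

theorem norm_det_shift_le {M : ℕ} (c : ℤ → ℂ) (z y : Fin M → ℤ) :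
    ‖Matrix.det (Matrix.of fun j k => c (z k - y j))‖ ≤
      ∑ σ : Equiv.Perm (Fin M), ∏ k, ‖c (z k - y (σ k))‖ := by
  rw [Matrix.det_apply']
  refine (norm_sum_le _ _).trans (Finset.sum_le_sum fun σ _ => ?_)
  rw [norm_mul, norm_prod]
  rcases Int.units_eq_one_or (Equiv.Perm.sign σ) with hs | hs <;> simp [hs]

theorem summable_norm_det_shift {M : ℕ} {c : ℤ → ℂ} (hc : Summable fun k => ‖c k‖)
    (y : Fin M → ℤ) :
    Summable fun z : Fin M → ℤ => ‖Matrix.det (Matrix.of fun j k => c (z k - y j))‖ := by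
  refine Summable.of_nonneg_of_le (fun _ => norm_nonneg _) (fun z => norm_det_shift_le c z y)
    (summable_sum fun σ _ => ?_)
  have h := (summable_norm_and_hasSum_prod_pi (fun k v => c (v - y (σ k)))
    fun k => (Equiv.subRight (y (σ k))).summable_iff.2 hc).1
  simpa only [norm_prod] using h

theorem summable_mul_norm_det_shift {M : ℕ} {c : ℤ → ℂ} (hc : Summable fun k => ‖c k‖)
    {G : (Fin M → ℤ) → ℝ} (hG0 : ∀ y, 0 ≤ G y) (hG : Summable G) :
    Summable fun p : (Fin M → ℤ) × (Fin M → ℤ) =>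
      G p.2 * ‖Matrix.det (Matrix.of fun j k => c (p.1 k - p.2 j))‖ := by
  refine Summable.of_nonneg_of_le (fun p => mul_nonneg (hG0 _) (norm_nonneg _))
    (fun p => mul_le_mul_of_nonneg_left (norm_det_shift_le c p.1 p.2) (hG0 _)) ?_
  simp only [Finset.mul_sum]
  refine summable_sum fun σ _ => ?_
  -- After the substitution `z = w + y ∘ σ` the two variables separate.
  let e : (Fin M → ℤ) × (Fin M → ℤ) ≃ (Fin M → ℤ) × (Fin M → ℤ) :=
    { toFun := fun p => (p.1 + p.2 ∘ σ, p.2)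
      invFun := fun p => (p.1 - p.2 ∘ σ, p.2)
      left_inv := fun p => by simp
      right_inv := fun p => by simp }
  rw [← e.summable_iff]
  have h := (summable_norm_and_hasSum_prod_pi (M := M) (fun _ v => c v) fun _ => hc).1
  refine (h.mul_of_nonneg hG (fun _ => norm_nonneg _) hG0).congr fun p => ?_
  simp [e, norm_prod, mul_comm]

theorem summable_prod_norm_det {M : ℕ} {d : ℤ} {φ : ℤ → ℂ → ℂ} {R : ℤ} (n : ℕ) :
    ∀ {L : ℤ}, R = L + 1 + n → (∀ s, L < s → s < R → Summable fun k => ‖fourier (φ s) k‖) →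
    ∀ G : (Fin M → ℤ) → ℝ, (∀ y, 0 ≤ G y) → Summable G →
    Summable fun x : Config L R M => G (position d x (L + 1)) * ∏ r ∈ Finset.Ioo L R,
      ‖Matrix.det (Matrix.of fun j k =>
        fourier (φ r) (position d x (r + 1) k - position d x r j))‖ := by
  induction n with
  | zero =>
    intro L hR _ G _ _
    obtain rfl : R = L + 1 := by simpa using hR
    have he : IsEmpty (Set.Ioo L (L + 1)) := ⟨fun r => by have := r.2.1; have := r.2.2; omega⟩
    exact .of_finite
  | succ n ih =>
    intro L hR hc G hG0 hG
    have hLR : L + 1 < R := by push_cast at hR; omega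
    have hI : Finset.Ioo L R = insert (L + 1) (Finset.Ioo (L + 1) R) := by
      ext r; simp only [Finset.mem_Ioo, Finset.mem_insert]; omega
    have hterm : ∀ p : Config (L + 1) R M × (Fin M → ℤ),
        G (position d (consConfig hLR p) (L + 1)) * ∏ r ∈ Finset.Ioo L R,
          ‖Matrix.det (Matrix.of fun j k => fourier (φ r) (position d (consConfig hLR p) (r + 1) k -
            position d (consConfig hLR p) r j))‖ =
        (G p.2 * ‖Matrix.det (Matrix.of fun j k =>
          fourier (φ (L + 1)) (position d p.1 (L + 1 + 1) k - p.2 j))‖) *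
        ∏ r ∈ Finset.Ioo (L + 1) R, ‖Matrix.det (Matrix.of fun j k =>
          fourier (φ r) (position d p.1 (r + 1) k - position d p.1 r j))‖ := by
      intro p
      have hself : position d (consConfig hLR p) (L + 1) = p.2 :=
        funext fun j => position_consConfig_self hLR d p j
      rw [hI, Finset.prod_insert (by simp), hself, ← mul_assoc]
      congr 1
      · simp only [position_consConfig_of_gt hLR d p (lt_add_one (L + 1))]
      · refine Finset.prod_congr rfl fun r hr => ?_
        have hr1 := (Finset.mem_Ioo.1 hr).1
        simp only [position_consConfig_of_gt hLR d p hr1,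
          position_consConfig_of_gt hLR d p (hr1.trans (lt_add_one r))]
    rw [← (consConfig hLR).summable_iff, Function.comp_def]
    simp only [hterm]
    have hGD := summable_mul_norm_det_shift (hc (L + 1) (lt_add_one L) hLR) hG0 hG
    have hnn : ∀ z y : Fin M → ℤ, 0 ≤ G y * ‖Matrix.det (Matrix.of fun j k =>
        fourier (φ (L + 1)) (z k - y j))‖ := fun z y => mul_nonneg (hG0 y) (norm_nonneg _)
    rw [summable_prod_of_nonneg fun p => mul_nonneg (hnn _ _)
      (Finset.prod_nonneg fun _ _ => norm_nonneg _)]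
    have hfib : ∀ z : Fin M → ℤ, Summable fun y => G y * ‖Matrix.det (Matrix.of fun j k =>
        fourier (φ (L + 1)) (z k - y j))‖ := fun z => hGD.prod_factor z
    refine ⟨fun x => ?_, ?_⟩
    · exact (hfib fun k => position d x (L + 1 + 1) k).mul_right (∏ r ∈ Finset.Ioo (L + 1) R,
        ‖Matrix.det (Matrix.of fun j k =>
          fourier (φ r) (position d x (r + 1) k - position d x r j))‖)
    simp only [tsum_mul_right]
    exact ih (by push_cast at hR; omega) (fun s hs => hc s (by omega))
      (fun z => ∑' y, G y * ‖Matrix.det (Matrix.of fun j k =>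
        fourier (φ (L + 1)) (z k - y j))‖) (fun z => tsum_nonneg (hnn z)) hGD.prod

theorem summable_weight {M : ℕ} {d : ℤ} {φ : ℤ → ℂ → ℂ} {L R : ℤ} (hLR : L < R)
    (hc : ∀ s, L ≤ s → s < R → Summable fun k => ‖fourier (φ s) k‖) :
    Summable fun x : Config L R M => weight d φ x := by
  refine Summable.of_norm ?_
  refine (summable_prod_norm_det (d := d) (R - L - 1).toNat (by omega)
    (fun s hs => hc s hs.le) (fun z => ‖Matrix.det (Matrix.of fun j k : Fin M =>
      fourier (φ L) (z k - (d - ((j : ℤ) + 1))))‖) (fun _ => norm_nonneg _)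
    (summable_norm_det_shift (hc L le_rfl hLR) _)).congr fun x => ?_
  rw [weight, ← Finset.Ioo_insert_left hLR, Finset.prod_insert (by simp), norm_mul, norm_prod]
  congr 4
  ext j k
  rw [position.eq_def d x L, dif_neg (by simp)]

/-! ### Fredholm expansion of a finite determinant -/

theorem sum_det_submatrix {S : Type*} [Fintype S] [DecidableEq S] (N : Matrix S S ℂ) (n : ℕ) :
    ∑ x : Fin n → S, (N.submatrix x x).det =
      (n.factorial : ℂ) * ∑ s ∈ Finset.univ.powersetCard n,
        (N.submatrix (Subtype.val : s → S) (Subtype.val : s → S)).det := by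
  classical
  rw [← Finset.sum_filter_of_ne (p := Function.Injective) (s := Finset.univ)
    fun x _ hx => by
      by_contra hni
      obtain ⟨i, j, hij, hne⟩ := Function.not_injective_iff.1 hni
      exact hx (Matrix.det_zero_of_row_eq hne (by ext k; simp [hij]))]
  rw [← Finset.sum_fiberwise_of_maps_to (s := Finset.univ.filter Function.Injective)
    (t := Finset.univ.powersetCard n) (g := fun x : Fin n → S => Finset.univ.image x)
    fun x hx => by
      rw [Finset.mem_powersetCard]
      exact ⟨Finset.subset_univ _, by
        rw [Finset.card_image_of_injective _ (Finset.mem_filter.1 hx).2, Finset.card_univ,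
          Fintype.card_fin]⟩, Finset.mul_sum]
  refine Finset.sum_congr rfl fun s hs => ?_
  have hcard : Fintype.card (Fin n ≃ s) = n.factorial := by
    rw [Fintype.card_equiv (Fintype.equivOfCardEq (by
      rw [Fintype.card_fin, Fintype.card_coe, (Finset.mem_powersetCard.1 hs).2])), Fintype.card_fin]
  rw [← hcard, ← nsmul_eq_mul, ← Finset.card_univ, ← Finset.sum_const]
  symm
  refine Finset.sum_bij (fun e _ i => ((e i : s) : S)) (fun e _ => ?_) (fun e _ e' _ h => ?_)
    (fun x hx => ?_) (fun e _ => ?_)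
  · simp only [Finset.mem_filter, Finset.mem_univ, true_and]
    refine ⟨Subtype.val_injective.comp e.injective, ?_⟩
    ext y
    simp only [Finset.mem_image, Finset.mem_univ, true_and]
    exact ⟨fun ⟨i, hi⟩ => hi ▸ (e i).2, fun hy => ⟨e.symm ⟨y, hy⟩, by simp⟩⟩
  · ext i
    exact congrFun h i
  · simp only [Finset.mem_filter, Finset.mem_univ, true_and] at hx
    refine ⟨Equiv.ofBijective (fun i => (⟨x i, hx.2 ▸ Finset.mem_image_of_mem x (Finset.mem_univ i)⟩ :
      s)) ⟨fun i j hij => hx.1 (congrArg Subtype.val hij), fun y => ?_⟩, Finset.mem_univ _, rfl⟩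
    obtain ⟨i, -, hi⟩ := Finset.mem_image.1 (hx.2 ▸ y.2 : (y : S) ∈ Finset.univ.image x)
    exact ⟨i, Subtype.ext hi⟩
  · rw [← Matrix.det_submatrix_equiv_self e]
    rfl

theorem hasSum_det_one_add {S : Type*} [Fintype S] [DecidableEq S] (N : Matrix S S ℂ) :
    HasSum (fun n : ℕ => (1 : ℂ) / n.factorial * ∑ x : Fin n → S, (N.submatrix x x).det)
      (1 + N).det := by
  let p : Polynomial ℂ := (1 + (Polynomial.X : Polynomial ℂ) • N.map Polynomial.C).det
  have hp : p.eval 1 = (1 + N).det := by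
    rw [← Polynomial.coe_evalRingHom, RingHom.map_det]
    congr 1
    ext i j
    simp [Matrix.one_apply, apply_ite]
  have hsum : HasSum (fun n => p.coeff n) (p.eval 1) := by
    rw [Polynomial.eval_eq_sum, Polynomial.sum]
    simp only [one_pow, mul_one]
    exact hasSum_sum_of_ne_finset_zero fun n hn => Polynomial.notMem_support_iff.1 hn
  rw [← hp]
  refine hsum.congr_fun fun n => ?_
  rw [Matrix.coeff_det_one_add_X_smul_eq_sum_minors, sum_det_submatrix, ← mul_assoc,
    one_div_mul_cancel (by exact_mod_cast n.factorial_ne_zero), one_mul]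

/-- The Fredholm expansion in the form in which it enters the definition of a determinantal
process. -/
theorem hasSum_fredholm {S : Type*} [DecidableEq S] (K : S → S → ℂ) (f : S →₀ ℂ) :
    HasSum (fun n : ℕ => (-1 : ℂ) ^ n / (n.factorial : ℂ) *
        ∑ x ∈ Fintype.piFinset (fun _ : Fin n => f.support),
          (∏ j, f (x j)) * Matrix.det (Matrix.of fun i j => K (x i) (x j)))
      (1 - Matrix.of fun p q : f.support => K p q * f q).det := by
  rw [sub_eq_add_neg]
  refine (hasSum_det_one_add _).congr_fun fun n => ?_
  rw [Finset.mul_sum, Finset.mul_sum]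
  symm
  refine Finset.sum_bij (fun x _ i => (x i : S)) (fun x _ => ?_) (fun x _ y _ h => ?_)
    (fun x hx => ?_) (fun x _ => ?_)
  · exact Fintype.mem_piFinset.2 fun i => (x i).2
  · funext i
    exact Subtype.ext (congrFun h i)
  · exact ⟨fun i => ⟨x i, Fintype.mem_piFinset.1 hx i⟩, Finset.mem_univ _, rfl⟩
  · have h1 := Matrix.det_mul_row (fun j => -f (x j))
      (Matrix.of fun i j : Fin n => K (x i) (x j))
    have h2 : (∏ j, -f (x j)) = (-1) ^ n * ∏ j, f (x j) := by
      rw [Finset.prod_neg, Finset.card_univ, Fintype.card_fin]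
    rw [h2] at h1
    have h3 : ((-Matrix.of fun p q : f.support => K p q * f q).submatrix x x) =
        Matrix.of fun i j => -f (x j) * (Matrix.of fun i j : Fin n => K (x i) (x j)) i j := by
      ext i j
      simp only [Matrix.submatrix_apply, Matrix.neg_apply, Matrix.of_apply]
      ring
    rw [h3, h1]
    ring

/-! ### The Eynard–Mehta theorem -/

theorem det_one_add_eq_one_of_strict {S : Type*} [Fintype S] [DecidableEq S] (b : S → ℤ)
    (N : Matrix S S ℂ) (h : ∀ p q, ¬ b p < b q → N p q = 0) : (1 + N).det = 1 := by
  have hB : (1 + N).BlockTriangular b := by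
    intro p q hpq
    rw [Matrix.add_apply, h p q hpq.not_gt, add_zero, Matrix.one_apply_ne]
    rintro rfl
    exact lt_irrefl _ hpq
  rw [hB.det]
  refine Finset.prod_eq_one fun a _ => ?_
  have : (1 + N).toSquareBlock b a = 1 := by
    ext p q
    rw [Matrix.toSquareBlock_def, Matrix.of_apply, Matrix.add_apply,
      h _ _ (by rw [p.2, q.2]; exact lt_irrefl _), add_zero]
    simp only [Matrix.one_apply, Subtype.ext_iff]
  rw [this, Matrix.det_one]

/-- The linear algebra behind the Eynard–Mehta theorem: the determinant of the transfer matrix that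
is perturbed at the sites of `S` is a determinant over `S`. -/
theorem det_sub_eq_det_mul_det {m S : Type*} [Fintype m] [DecidableEq m] [Fintype S]
    [DecidableEq S] {A : Matrix m m ℂ} (hA : IsUnit A.det) {g Ψ : Matrix m S ℂ}
    {F W : Matrix S S ℂ} (Φ : Matrix S m ℂ) (hg : g * (1 + F * W) = Ψ) (hW : (1 + W * F).det = 1) :
    (A - g * F * Φ).det = A.det * (1 - (-W + Φ * A⁻¹ * Ψ) * F).det := by
  have h1 : A - g * F * Φ = A * (1 - A⁻¹ * (g * F) * Φ) := by
    rw [Matrix.mul_sub, Matrix.mul_one, ← Matrix.mul_assoc A, ← Matrix.mul_assoc A,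
      Matrix.mul_nonsing_inv _ hA, Matrix.one_mul]
  rw [h1, Matrix.det_mul, Matrix.det_one_sub_mul_comm, ← mul_one (Matrix.det (1 - _)), ← hW,
    ← Matrix.det_mul]
  congr 2
  rw [← hg]
  simp only [Matrix.mul_add, Matrix.add_mul, Matrix.sub_mul, Matrix.mul_assoc, Matrix.one_mul,
    Matrix.mul_one, Matrix.neg_mul]
  abel

/-- A function on the sites, as a function of level and position that vanishes at the levels
`≤ L` and `≥ R`. -/
def levelFun {L R : ℤ} (f : Site L R →₀ ℂ) (r v : ℤ) : ℂ :=
  if h : r ∈ Set.Ioo L R then f (⟨r, h⟩, v) else 0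

theorem levelFun_of_mem {L R : ℤ} (f : Site L R →₀ ℂ) {r : ℤ} (h : r ∈ Set.Ioo L R) (v : ℤ) :
    levelFun f r v = f (⟨r, h⟩, v) := dif_pos h

theorem prod_particles {L R : ℤ} {M : ℕ} (d : ℤ) (f : Site L R →₀ ℂ) (x : Config L R M) :
    ∏ p ∈ f.support, (1 - f p) ^ particles x p =
      ∏ r ∈ Finset.Ioo L R, ∏ j, (1 - levelFun f r (position d x r j)) := by
  have h1 : ∏ r ∈ Finset.Ioo L R, ∏ j, (1 - levelFun f r (position d x r j)) =
      ∏ r : Set.Ioo L R, ∏ j, (1 - f (r, x r j)) := by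
    rw [Finset.prod_subtype (Finset.Ioo L R) (p := fun r => r ∈ Set.Ioo L R)
      (fun r => by simp) fun r => ∏ j, (1 - levelFun f r (position d x r j))]
    refine Finset.prod_congr rfl fun r _ => Finset.prod_congr rfl fun j _ => ?_
    rw [levelFun_of_mem f r.2, position, dif_pos r.2]
  rw [h1]
  have h2 : ∀ q : Site L R, 1 - f q = ∏ p ∈ f.support, if p = q then 1 - f p else 1 := by
    intro q
    rw [Finset.prod_ite_eq']
    split_ifs with h
    · rfl
    · rw [Finsupp.notMem_support_iff.1 h, sub_zero]
  have h3 : ∏ r : Set.Ioo L R, ∏ j, (1 - f (r, x r j)) =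
      ∏ r : Set.Ioo L R, ∏ j, ∏ p ∈ f.support, if p = (r, x r j) then 1 - f p else 1 :=
    Finset.prod_congr rfl fun r _ => Finset.prod_congr rfl fun j _ => h2 _
  rw [h3, Finset.prod_congr rfl fun r _ => Finset.prod_comm, Finset.prod_comm]
  refine Finset.prod_congr rfl fun p _ => ?_
  rw [Finset.prod_eq_single p.1]
  · rw [particles, ← Finset.prod_const, Finset.prod_filter]
    refine Finset.prod_congr rfl fun j _ => ?_
    congr 1
    simp only [eq_iff_iff, Prod.ext_iff, true_and]
    exact eq_comm
  · intro r _ hr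
    exact Finset.prod_eq_one fun j _ => if_neg fun h => hr (congrArg Prod.fst h).symm
  · intro h
    exact absurd (Finset.mem_univ _) h

/-- The coefficients `p_{L,s}(x_i^L, v)`, at the sites of `S`. -/
def leftMatrix (L R d : ℤ) (M : ℕ) (φ : ℤ → ℂ → ℂ) (S : Finset (Site L R)) :
    Matrix (Fin M) S ℂ :=
  Matrix.of fun i p => fourier (chain φ L p.1.1) (p.1.2 + ((i : ℤ) + 1) - d)

/-- The coefficients `p_{r,R}(u, x_j^R)`, at the sites of `S`. -/
def rightMatrix (L R d : ℤ) (M : ℕ) (φ : ℤ → ℂ → ℂ) (S : Finset (Site L R)) :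
    Matrix S (Fin M) ℂ :=
  Matrix.of fun p j => fourier (chain φ p.1.1 R) (d - ((j : ℤ) + 1) - p.1.2)

/-- The coefficients `p_{r,s}(u, v)`, at pairs of sites of `S`. -/
def middleMatrix (L R : ℤ) (φ : ℤ → ℂ → ℂ) (S : Finset (Site L R)) : Matrix S S ℂ :=
  Matrix.of fun p q => transition φ p.1.1 q.1.1 p.1.2 q.1.2

/-- The restriction of `f` to its support, as a diagonal matrix. -/
def diagMatrix {S : Type*} [DecidableEq S] (f : S →₀ ℂ) : Matrix f.support f.support ℂ :=
  Matrix.diagonal fun p => f p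

theorem middleMatrix_eq_zero {L R : ℤ} {φ : ℤ → ℂ → ℂ} {S : Finset (Site L R)} {p q : S}
    (h : ¬ (p.1.1 : ℤ) < q.1.1) : middleMatrix L R φ S p q = 0 := by
  rw [middleMatrix, Matrix.of_apply, transition, if_neg h]

theorem det_one_add_diag_mul_middle {L R : ℤ} (φ : ℤ → ℂ → ℂ) (f : Site L R →₀ ℂ) :
    (1 + diagMatrix f * middleMatrix L R φ f.support).det = 1 := by
  refine det_one_add_eq_one_of_strict (fun p => p.1.1) _ fun p q h => ?_
  rw [diagMatrix, Matrix.diagonal_mul, middleMatrix_eq_zero h, mul_zero]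

theorem det_one_add_middle_mul_diag {L R : ℤ} (φ : ℤ → ℂ → ℂ) (f : Site L R →₀ ℂ) :
    (1 + middleMatrix L R φ f.support * diagMatrix f).det = 1 := by
  refine det_one_add_eq_one_of_strict (fun p => p.1.1) _ fun p q h => ?_
  rw [diagMatrix, Matrix.mul_diagonal, middleMatrix_eq_zero h, zero_mul]

/-- The vectors `g = Ψ (1 + F W)⁻¹` that collect all visits to the sites in the support of `f`
before a given site. -/
def visitMatrix (L R d : ℤ) (M : ℕ) (φ : ℤ → ℂ → ℂ) (f : Site L R →₀ ℂ) :
    Matrix (Fin M) f.support ℂ :=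
  leftMatrix L R d M φ f.support * (1 + diagMatrix f * middleMatrix L R φ f.support)⁻¹

theorem visitMatrix_mul (L R d : ℤ) (M : ℕ) (φ : ℤ → ℂ → ℂ) (f : Site L R →₀ ℂ) :
    visitMatrix L R d M φ f * (1 + diagMatrix f * middleMatrix L R φ f.support) =
      leftMatrix L R d M φ f.support := by
  rw [visitMatrix, Matrix.mul_assoc, Matrix.nonsing_inv_mul _ (by
    rw [det_one_add_diag_mul_middle]; exact isUnit_one), Matrix.mul_one]

/-- The functions `v ↦ p_{L,s}(x_i^L, v)` with the factors `1 - f` inserted at all the levels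
between `L` and `s`. -/
def propagated (L R d : ℤ) (M : ℕ) (φ : ℤ → ℂ → ℂ) (f : Site L R →₀ ℂ) (s : ℤ) (i : Fin M)
    (v : ℤ) : ℂ :=
  fourier (chain φ L s) (v + ((i : ℤ) + 1) - d) -
    ∑ p : f.support, visitMatrix L R d M φ f i p * f p * transition φ p.1.1 s p.1.2 v

theorem propagated_mul_levelFun {L R d : ℤ} {M : ℕ} {φ : ℤ → ℂ → ℂ} (f : Site L R →₀ ℂ) (s : ℤ)
    (i : Fin M) (v : ℤ) :
    propagated L R d M φ f s i v * levelFun f s v =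
      ∑ p : f.support, if (p.1.1 : ℤ) = s ∧ p.1.2 = v then visitMatrix L R d M φ f i p * f p
        else 0 := by
  by_cases hs : s ∈ Set.Ioo L R
  · rw [levelFun_of_mem f hs]
    by_cases hp : ((⟨s, hs⟩, v) : Site L R) ∈ f.support
    · rw [Finset.sum_eq_single (⟨(⟨s, hs⟩, v), hp⟩ : f.support)]
      · simp only [and_self, if_true]
        congr 1
        have h := congrFun (congrFun (visitMatrix_mul L R d M φ f) i) ⟨(⟨s, hs⟩, v), hp⟩
        rw [Matrix.mul_add, Matrix.mul_one, Matrix.add_apply, ← Matrix.mul_assoc, Matrix.mul_apply]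
          at h
        rw [propagated, sub_eq_iff_eq_add]
        refine h.symm.trans ?_
        congr 1
        refine Finset.sum_congr rfl fun p _ => ?_
        rw [diagMatrix, Matrix.mul_diagonal]
        rfl
      · intro p _ hne
        refine if_neg fun h => hne (Subtype.ext (Prod.ext (Subtype.ext h.1) h.2))
      · intro h
        exact absurd (Finset.mem_univ _) h
    · rw [Finsupp.notMem_support_iff.1 hp, mul_zero]
      symm
      refine Finset.sum_eq_zero fun p _ => if_neg fun h => hp ?_
      have : p.1 = (⟨s, hs⟩, v) := Prod.ext (Subtype.ext h.1) h.2
      rw [← this]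
      exact p.2
  · rw [levelFun, dif_neg hs, mul_zero]
    symm
    refine Finset.sum_eq_zero fun p _ => if_neg fun h => hs ?_
    rw [← h.1]
    exact p.1.1.2

theorem hasSum_chain_mul {a b : ℝ} (ha : 0 ≤ a) (ha1 : a < 1) (hb1 : 1 < b) {L R : ℤ}
    {φ ψ : ℤ → ℂ → ℂ} (hψ : ∀ q, L ≤ q → q < R → DifferentiableOn ℂ (ψ q) (annulus a b))
    (hφ : ∀ q, L ≤ q → q < R → ∀ z : ℂ, ‖z‖ = 1 → φ q z = ψ q z) {r s : ℤ} (hLr : L ≤ r)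
    (hrs : r ≤ s) (hsR : s < R) (u z : ℤ) :
    HasSum (fun y => fourier (chain φ r s) (y - u) * fourier (φ s) (z - y))
      (fourier (chain φ r (s + 1)) (z - u)) := by
  have hch : ∀ t, t ≤ R → ∀ w : ℂ, ‖w‖ = 1 → chain φ r t w = chain ψ r t w := fun t ht w hw =>
    Finset.prod_congr rfl fun q hq => hφ q (hLr.trans (Finset.mem_Ico.1 hq).1)
      ((Finset.mem_Ico.1 hq).2.trans_le ht) w hw
  have hd : DifferentiableOn ℂ (chain ψ r s) (annulus a b) :=
    DifferentiableOn.fun_finsetProd fun q hq => hψ q (hLr.trans (Finset.mem_Ico.1 hq).1)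
      ((Finset.mem_Ico.1 hq).2.trans hsR)
  have h := hasSum_fourier_mul_shift ha ha1 hb1 (hψ s (hLr.trans hrs) hsR) hd z u
  have e : fourier (chain φ r (s + 1)) (z - u) = fourier (fun w => ψ s w * chain ψ r s w) (z - u) :=
    fourier_congr (fun w hw => by
      rw [hch _ (by omega) w hw, ← chain_mul_chain ψ hrs (by omega : s ≤ s + 1), mul_comm]
      congr 1
      rw [chain, show Finset.Ico s (s + 1) = {s} by ext q; simp; omega, Finset.prod_singleton]) _
  rw [e]
  refine h.congr_fun fun y => ?_
  rw [mul_comm, fourier_congr (hφ s (hLr.trans hrs) hsR), fourier_congr (hch s hsR.le)]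

theorem chain_succ_self (φ : ℤ → ℂ → ℂ) (s : ℤ) : chain φ s (s + 1) = φ s := by
  funext z
  rw [chain, show Finset.Ico s (s + 1) = {s} by ext q; simp; omega, Finset.prod_singleton]

theorem hasSum_propagated {a b : ℝ} (ha : 0 ≤ a) (ha1 : a < 1) (hb1 : 1 < b) {L R d : ℤ}
    {φ ψ : ℤ → ℂ → ℂ} (hψ : ∀ q, L ≤ q → q < R → DifferentiableOn ℂ (ψ q) (annulus a b))
    (hφ : ∀ q, L ≤ q → q < R → ∀ z : ℂ, ‖z‖ = 1 → φ q z = ψ q z) {M : ℕ} (f : Site L R →₀ ℂ)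
    {s : ℤ} (hLs : L < s) (hsR : s < R) (i : Fin M) (z : ℤ) :
    HasSum (fun y => propagated L R d M φ f s i y * (1 - levelFun f s y) * fourier (φ s) (z - y))
      (propagated L R d M φ f (s + 1) i z) := by
  have h1 : HasSum (fun y => fourier (chain φ L s) (y + ((i : ℤ) + 1) - d) * fourier (φ s) (z - y))
      (fourier (chain φ L (s + 1)) (z + ((i : ℤ) + 1) - d)) := by
    have := hasSum_chain_mul ha ha1 hb1 hψ hφ le_rfl hLs.le hsR (d - ((i : ℤ) + 1)) z
    simpa only [← sub_add, sub_add_eq_add_sub] using this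
  have h2 : ∀ p : f.support, HasSum (fun y => visitMatrix L R d M φ f i p * f p *
      transition φ p.1.1 s p.1.2 y * fourier (φ s) (z - y) +
      (if (p.1.1 : ℤ) = s ∧ p.1.2 = y then visitMatrix L R d M φ f i p * f p else 0) *
        fourier (φ s) (z - y))
      (visitMatrix L R d M φ f i p * f p * transition φ p.1.1 (s + 1) p.1.2 z) := by
    intro p
    have hp := p.1.1.2.1
    simp only [transition]
    rcases lt_trichotomy (p.1.1 : ℤ) s with h | h | h
    · simp only [h.ne, false_and, if_false, zero_mul, add_zero, if_pos h,
        if_pos (show (p.1.1 : ℤ) < s + 1 by omega), mul_assoc]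
      exact ((hasSum_chain_mul ha ha1 hb1 hψ hφ hp.le h.le hsR _ z).mul_left _).mul_left _
    · simp only [h, lt_irrefl, if_false, mul_zero, zero_mul, zero_add, true_and, lt_add_one, if_true,
        chain_succ_self, ite_mul]
      convert! hasSum_ite_eq p.1.2
        (visitMatrix L R d M φ f i p * f p * fourier (φ s) (z - p.1.2)) using 2 with y
      by_cases hy : y = p.1.2
      · rw [hy, if_pos rfl]
      · rw [if_neg hy, if_neg (Ne.symm hy)]
    · simp only [h.ne', false_and, if_false, zero_mul, add_zero, if_neg h.not_gt,
        if_neg (show ¬ (p.1.1 : ℤ) < s + 1 by omega), mul_zero]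
      exact hasSum_zero
  refine (h1.sub (hasSum_sum fun p (_ : p ∈ Finset.univ) => h2 p)).congr_fun fun y => ?_
  rw [mul_sub, mul_one, propagated_mul_levelFun, propagated, Finset.sum_add_distrib,
    ← Finset.sum_mul, ← Finset.sum_mul]
  ring

/-- The generating function of the particle numbers, before normalization, as a determinant of
size `M`. -/
theorem tsum_weight_mul_prod {a b : ℝ} (ha : 0 ≤ a) (ha1 : a < 1) (hb1 : 1 < b) {L R d : ℤ}
    (hLR : L < R) {φ ψ : ℤ → ℂ → ℂ}
    (hψ : ∀ q, L ≤ q → q < R → DifferentiableOn ℂ (ψ q) (annulus a b))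
    (hφ : ∀ q, L ≤ q → q < R → ∀ z : ℂ, ‖z‖ = 1 → φ q z = ψ q z) {M : ℕ} (f : Site L R →₀ ℂ)
    (hs : Summable fun x : Config L R M =>
      weight d φ x * ∏ p ∈ f.support, (1 - f p) ^ particles x p) :
    ∑' x : Config L R M, weight d φ x * ∏ p ∈ f.support, (1 - f p) ^ particles x p =
      (M.factorial : ℂ) ^ (R - L - 1).toNat * (toeplitz M (chain φ L R) -
        visitMatrix L R d M φ f * diagMatrix f * rightMatrix L R d M φ f.support).det := by
  have hterm : ∀ x : Config L R M, weight d φ x * ∏ p ∈ f.support, (1 - f p) ^ particles x p =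
      Matrix.det (Matrix.of fun i k => propagated L R d M φ f (L + 1) i (position d x (L + 1) k)) *
        ∏ r ∈ Finset.Ioo L R, ((∏ j, (1 - levelFun f r (position d x r j))) *
          Matrix.det (Matrix.of fun j k =>
            fourier (φ r) (position d x (r + 1) k - position d x r j))) := by
    intro x
    rw [prod_particles d f x, weight, ← Finset.Ioo_insert_left hLR, Finset.prod_insert (by simp),
      Finset.prod_mul_distrib]
    have h1 : (Matrix.of fun j k : Fin M =>
        fourier (φ L) (position d x (L + 1) k - position d x L j)) =
        Matrix.of fun i k => propagated L R d M φ f (L + 1) i (position d x (L + 1) k) := by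
      ext i k
      rw [Matrix.of_apply, Matrix.of_apply, propagated, chain_succ_self, Finset.sum_eq_zero, sub_zero]
      · congr 1
        conv_lhs => rw [position.eq_def d x L, dif_neg (by simp)]
        ring
      · intro p _
        have hp := p.1.1.2.1
        rw [transition, if_neg (by omega), mul_zero]
    rw [h1]
    ring
  simp only [hterm] at hs ⊢
  rw [tsum_det_mul_prod (g := propagated L R d M φ f) (R - L - 1).toNat (by omega)
    (fun s h1 h2 i z => hasSum_propagated ha ha1 hb1 hψ hφ f h1 h2 i z) hs]
  congr 2
  ext i k
  rw [Matrix.of_apply, propagated, Matrix.sub_apply, toeplitz, Matrix.of_apply, Matrix.mul_apply]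
  congr 1
  · congr 1; ring
  · refine Finset.sum_congr rfl fun p _ => ?_
    rw [diagMatrix, Matrix.mul_diagonal, rightMatrix, Matrix.of_apply, transition,
      if_pos p.1.1.2.2]

/-! ### The probability measure and its particle and hole processes -/

/-- The analytic input on the symbols that the probabilistic part uses: on the unit circle, the
symbols `φ q`, `L ≤ q < R`, agree with functions `ψ q` that are analytic in the annulus
`a < ‖z‖ < b` around it. -/
structure AnalyticSymbols (a b : ℝ) (L R : ℤ) (φ ψ : ℤ → ℂ → ℂ) : Prop where
  nonneg : 0 ≤ a
  lt_one : a < 1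
  one_lt : 1 < b
  lt : L < R
  differentiableOn : ∀ q, L ≤ q → q < R → DifferentiableOn ℂ (ψ q) (annulus a b)
  eq_on_circle : ∀ q, L ≤ q → q < R → ∀ z : ℂ, ‖z‖ = 1 → φ q z = ψ q z

theorem AnalyticSymbols.summable_weight {a b : ℝ} {L R : ℤ} {φ ψ : ℤ → ℂ → ℂ}
    (hA : AnalyticSymbols a b L R φ ψ) (M : ℕ) (d : ℤ) :
    Summable fun x : Config L R M => weight d φ x :=
  ToeplitzPaths.summable_weight hA.lt fun s h1 h2 => by
    simp only [fourier_congr (hA.eq_on_circle s h1 h2)]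
    exact summable_fourier hA.nonneg hA.lt_one hA.one_lt (hA.differentiableOn s h1 h2)

section Measure

variable {a b : ℝ} {L R d : ℤ} {M : ℕ} {φ ψ : ℤ → ℂ → ℂ}

instance : Countable (Config L R M) := inferInstanceAs (Countable (Set.Ioo L R → Fin M → ℤ))

instance : MeasurableSingletonClass (Config L R M) :=
  inferInstanceAs (MeasurableSingletonClass (Set.Ioo L R → Fin M → ℤ))

theorem tsum_weight_pos (hZ : 0 < partitionFunction L R M d φ) :
    0 < ∑' x : Config L R M, weight d φ x := by
  have hM : (0 : ℂ) < (M.factorial : ℂ) ^ (R - L - 1).toNat := by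
    have : (0 : ℝ) < (M.factorial : ℝ) ^ (R - L - 1).toNat := by
      have := M.factorial_pos
      positivity
    exact_mod_cast this
  have h := mul_pos hZ hM
  rwa [partitionFunction, div_mul_cancel₀ _ hM.ne'] at h

theorem density_eq (x : Config L R M) :
    density d φ x = weight d φ x / ∑' y : Config L R M, weight d φ y := by
  have hM : (M.factorial : ℂ) ^ (R - L - 1).toNat ≠ 0 :=
    pow_ne_zero _ (by exact_mod_cast M.factorial_ne_zero)
  rw [density, partitionFunction, mul_div_cancel₀ _ hM]

theorem density_nonneg (hweight : ∀ x : Config L R M, 0 ≤ weight d φ x)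
    (hZ : 0 < partitionFunction L R M d φ) (x : Config L R M) : 0 ≤ density d φ x := by
  rw [density_eq]
  exact div_nonneg (hweight x) (tsum_weight_pos hZ).le

theorem hasSum_density (hA : AnalyticSymbols a b L R φ ψ)
    (hZ : 0 < partitionFunction L R M d φ) :
    HasSum (fun x : Config L R M => density d φ x) 1 := by
  have h := (hA.summable_weight M d).hasSum.div_const (∑' x : Config L R M, weight d φ x)
  rw [div_self (tsum_weight_pos hZ).ne'] at h
  exact h.congr_fun fun x => density_eq x

theorem pathMeasure_singleton (x : Config L R M) :
    pathMeasure L R M d φ {x} = ENNReal.ofReal (density d φ x).re := by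
  rw [pathMeasure, MeasureTheory.withDensity_apply _ (MeasurableSet.singleton x),
    MeasureTheory.lintegral_singleton]
  simp

theorem isProbabilityMeasure_pathMeasure (hA : AnalyticSymbols a b L R φ ψ)
    (hweight : ∀ x : Config L R M, 0 ≤ weight d φ x)
    (hZ : 0 < partitionFunction L R M d φ) :
    MeasureTheory.IsProbabilityMeasure (pathMeasure L R M d φ) := by
  refine ⟨?_⟩
  rw [pathMeasure, MeasureTheory.withDensity_apply _ MeasurableSet.univ,
    MeasureTheory.Measure.restrict_univ, MeasureTheory.lintegral_count]
  have h := (hasSum_density hA hZ).mapL Complex.reCLM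
  simp only [Complex.reCLM_apply, Complex.one_re] at h
  rw [← ENNReal.ofReal_tsum_of_nonneg
    (fun x => (Complex.nonneg_iff.1 (density_nonneg hweight hZ x)).1) h.summable, h.tsum_eq,
    ENNReal.ofReal_one]

theorem integrable_of_bounded (hA : AnalyticSymbols a b L R φ ψ)
    (hweight : ∀ x : Config L R M, 0 ≤ weight d φ x)
    (hZ : 0 < partitionFunction L R M d φ) {F : Config L R M → ℂ} {C : ℝ} (hC : ∀ x, ‖F x‖ ≤ C) :
    MeasureTheory.Integrable F (pathMeasure L R M d φ) := by
  have := isProbabilityMeasure_pathMeasure hA hweight hZ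
  exact MeasureTheory.Integrable.of_bound (Measurable.of_discrete.aestronglyMeasurable) C
    (Filter.Eventually.of_forall hC)

theorem integral_pathMeasure (hA : AnalyticSymbols a b L R φ ψ)
    (hweight : ∀ x : Config L R M, 0 ≤ weight d φ x)
    (hZ : 0 < partitionFunction L R M d φ) {F : Config L R M → ℂ} {C : ℝ} (hC : ∀ x, ‖F x‖ ≤ C) :
    ∫ x, F x ∂(pathMeasure L R M d φ) =
      (∑' x : Config L R M, weight d φ x * F x) / ∑' x : Config L R M, weight d φ x := by
  rw [MeasureTheory.integral_countable (integrable_of_bounded hA hweight hZ hC), ← tsum_div_const]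
  refine tsum_congr fun x => ?_
  have h0 := Complex.nonneg_iff.1 (density_nonneg hweight hZ x)
  have h1 : (((density d φ x).re : ℝ) : ℂ) = density d φ x := Complex.ext rfl h0.2
  rw [MeasureTheory.measureReal_def, pathMeasure_singleton, ENNReal.toReal_ofReal h0.1,
    Complex.real_smul, h1, density_eq]
  ring

theorem norm_prod_pow_le {S : Type*} (s : Finset S) (f : S → ℂ) {n : S → ℕ} {N : ℕ}
    (hn : ∀ p, n p ≤ N) :
    ‖∏ p ∈ s, (1 - f p) ^ n p‖ ≤ ∏ p ∈ s, (1 + ‖f p‖) ^ N := by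
  rw [norm_prod]
  refine Finset.prod_le_prod (fun _ _ => norm_nonneg _) fun p _ => ?_
  rw [norm_pow]
  have h1 : ‖1 - f p‖ ≤ 1 + ‖f p‖ := (norm_sub_le _ _).trans (by simp)
  exact (pow_le_pow_left₀ (norm_nonneg _) h1 _).trans
    (pow_le_pow_right₀ (by linarith [norm_nonneg (f p)]) (hn p))

theorem particles_le (x : Config L R M) (p : Site L R) : particles x p ≤ M := by
  refine (Finset.card_filter_le _ _).trans ?_
  simp

theorem holes_le (x : Config L R M) (p : Site L R) : holes x p ≤ 1 := by
  unfold holes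
  split_ifs <;> omega

/-- The process is simple: a determinant with two equal rows vanishes. -/
theorem particles_le_one_of_weight_ne_zero {x : Config L R M} (h : weight d φ x ≠ 0)
    (p : Site L R) : particles x p ≤ 1 := by
  by_contra hlt
  obtain ⟨j, hj, k, hk, hjk⟩ := Finset.one_lt_card.1 (not_le.1 hlt)
  refine h (Finset.prod_eq_zero (i := (p.1 : ℤ))
    (Finset.mem_Ico.2 ⟨p.1.2.1.le, p.1.2.2⟩) (Matrix.det_zero_of_row_eq hjk ?_))
  have hj' := (Finset.mem_filter.1 hj).2
  have hk' := (Finset.mem_filter.1 hk).2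
  ext l
  simp only [Matrix.of_apply]
  congr 2
  rw [position, position, dif_pos p.1.2, dif_pos p.1.2]
  exact hj'.trans hk'.symm

end Measure

section Determinantal

variable {a b : ℝ} {L R d : ℤ} {M : ℕ} {φ ψ : ℤ → ℂ → ℂ}

theorem summable_weight_mul (hA : AnalyticSymbols a b L R φ ψ) {F : Config L R M → ℂ} {C : ℝ}
    (hC : ∀ x, ‖F x‖ ≤ C) : Summable fun x : Config L R M => weight d φ x * F x := by
  refine Summable.of_norm_bounded ((hA.summable_weight M d).norm.mul_right C) fun x => ?_
  rw [norm_mul]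
  exact mul_le_mul_of_nonneg_left (hC x) (norm_nonneg _)

theorem tsum_weight (hA : AnalyticSymbols a b L R φ ψ) :
    ∑' x : Config L R M, weight d φ x =
      (M.factorial : ℂ) ^ (R - L - 1).toNat * (toeplitz M (chain φ L R)).det := by
  have h := tsum_weight_mul_prod (d := d) (M := M) hA.nonneg hA.lt_one hA.one_lt hA.lt
    hA.differentiableOn hA.eq_on_circle (0 : Site L R →₀ ℂ) (by
      simpa using hA.summable_weight M d)
  simp only [Finsupp.support_zero, Finset.prod_empty, mul_one] at h
  rw [h]
  congr 2
  rw [sub_eq_self]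
  ext i j
  rw [Matrix.mul_apply]
  exact Finset.sum_eq_zero fun p _ => absurd p.2 (Finset.notMem_empty _)

/-- The partition function is the Toeplitz determinant. -/
theorem isUnit_det_toeplitz (hA : AnalyticSymbols a b L R φ ψ)
    (hZ : 0 < partitionFunction L R M d φ) : IsUnit (toeplitz M (chain φ L R)).det := by
  have h := (tsum_weight_pos hZ).ne'
  rw [tsum_weight hA] at h
  exact isUnit_iff_ne_zero.2 (right_ne_zero_of_mul h)

/-- The generating function of the particle numbers is a determinant over the sites. -/
theorem integral_prod_particles (hA : AnalyticSymbols a b L R φ ψ)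
    (hweight : ∀ x : Config L R M, 0 ≤ weight d φ x) (hZ : 0 < partitionFunction L R M d φ)
    (f : Site L R →₀ ℂ) {S : Finset (Site L R)} (hS : f.support = S) :
    ∫ x, ∏ p ∈ S, (1 - f p) ^ particles x p ∂(pathMeasure L R M d φ) =
      (1 - Matrix.of fun p q : S =>
        pathKernel L R M d φ p.1.1 p.1.2 q.1.1 q.1.2 * f q).det := by
  subst hS
  have hb := fun x : Config L R M => norm_prod_pow_le f.support f (particles_le x)
  have hdet := isUnit_det_toeplitz hA hZ
  rw [integral_pathMeasure hA hweight hZ hb, tsum_weight_mul_prod (d := d) (M := M) hA.nonneg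
    hA.lt_one hA.one_lt hA.lt hA.differentiableOn hA.eq_on_circle f (summable_weight_mul hA hb),
    tsum_weight hA, det_sub_eq_det_mul_det hdet (rightMatrix L R d M φ f.support)
      (visitMatrix_mul L R d M φ f) (det_one_add_middle_mul_diag φ f), ← mul_assoc,
    mul_div_cancel_left₀ _ (tsum_weight hA ▸ (tsum_weight_pos hZ).ne')]
  congr 2
  ext p q
  rw [diagMatrix, Matrix.mul_diagonal, Matrix.of_apply, pathKernel, Matrix.add_apply,
    Matrix.neg_apply, Matrix.mul_apply]
  congr 2
  refine Finset.sum_congr rfl fun i _ => ?_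
  rw [Matrix.mul_apply, Finset.sum_mul]
  rfl

theorem isDeterminantal_particles (hA : AnalyticSymbols a b L R φ ψ)
    (hweight : ∀ x : Config L R M, 0 ≤ weight d φ x) (hZ : 0 < partitionFunction L R M d φ) :
    IsDeterminantal (pathMeasure L R M d φ) particles
      (fun p q : Site L R => pathKernel L R M d φ p.1 p.2 q.1 q.2) := by
  intro f
  refine ⟨integrable_of_bounded hA hweight hZ fun x => norm_prod_pow_le f.support f (particles_le x), ?_⟩
  rw [integral_prod_particles hA hweight hZ f rfl]
  exact hasSum_fredholm (fun p q : Site L R => pathKernel L R M d φ p.1 p.2 q.1 q.2) f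

/-- For `f` without the value `1`, exchanging particles and holes amounts to replacing `1 - f` by
its inverse. -/
theorem integral_prod_holes_of_ne_one (hA : AnalyticSymbols a b L R φ ψ)
    (hweight : ∀ x : Config L R M, 0 ≤ weight d φ x) (hZ : 0 < partitionFunction L R M d φ)
    (f : Site L R →₀ ℂ) (hf : ∀ p, f p ≠ 1) {S : Finset (Site L R)} (hS : f.support = S) :
    ∫ x, ∏ p ∈ S, (1 - f p) ^ holes x p ∂(pathMeasure L R M d φ) =
      (1 - Matrix.of fun p q : S =>
        dualPathKernel L R M d φ p.1.1 p.1.2 q.1.1 q.1.2 * f q).det := by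
  let f' : Site L R →₀ ℂ := f.mapRange (fun z => -z / (1 - z)) (by simp)
  have hf' : ∀ p, f' p = -f p / (1 - f p) := fun p => rfl
  have hne : ∀ p, 1 - f p ≠ 0 := fun p => sub_ne_zero.2 (hf p).symm
  have hS' : f'.support = S := by
    rw [← hS]
    ext p
    rw [Finsupp.mem_support_iff, Finsupp.mem_support_iff, hf', ne_eq, div_eq_zero_iff, neg_eq_zero,
      or_iff_left (hne p)]
  have hinv : ∀ p, 1 - f' p = (1 - f p)⁻¹ := fun p => by
    have := hne p
    rw [hf']; field_simp; ring
  have hint := integral_prod_particles hA hweight hZ f' hS'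
  rw [integral_pathMeasure hA hweight hZ fun x => norm_prod_pow_le S f' (particles_le x)] at hint
  rw [integral_pathMeasure hA hweight hZ fun x => norm_prod_pow_le S f (holes_le x)]
  have hterm : ∀ x : Config L R M, weight d φ x * ∏ p ∈ S, (1 - f p) ^ holes x p =
      (∏ p ∈ S, (1 - f p)) * (weight d φ x * ∏ p ∈ S, (1 - f' p) ^ particles x p) := by
    intro x
    by_cases hw : weight d φ x = 0
    · rw [hw, zero_mul, zero_mul, mul_zero]
    · rw [mul_left_comm, ← Finset.prod_mul_distrib]
      congr 1
      refine Finset.prod_congr rfl fun p _ => ?_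
      have h1 := particles_le_one_of_weight_ne_zero hw p
      rw [hinv, holes]
      rcases Nat.le_one_iff_eq_zero_or_eq_one.1 h1 with h | h
      · rw [h]; simp
      · rw [h]; simp [hne p]
  simp only [hterm]
  rw [tsum_mul_left, mul_div_assoc, hint, ← Finset.prod_coe_sort, ← Matrix.det_mul_row]
  congr 1
  ext p q
  simp only [Matrix.of_apply, Matrix.sub_apply, dualPathKernel, hf']
  have h1 : (1 : Matrix S S ℂ) p q =
      if (p.1.1 : ℤ) = q.1.1 ∧ p.1.2 = q.1.2 then 1 else 0 := by
    rw [Matrix.one_apply]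
    congr 1
    simp only [Subtype.ext_iff, Prod.ext_iff]
  rw [h1]
  have := hne q
  field_simp
  ring

theorem integral_prod_holes (hA : AnalyticSymbols a b L R φ ψ)
    (hweight : ∀ x : Config L R M, 0 ≤ weight d φ x) (hZ : 0 < partitionFunction L R M d φ)
    (f : Site L R →₀ ℂ) :
    ∫ x, ∏ p ∈ f.support, (1 - f p) ^ holes x p ∂(pathMeasure L R M d φ) =
      (1 - Matrix.of fun p q : f.support =>
        dualPathKernel L R M d φ p.1.1 p.1.2 q.1.1 q.1.2 * f q).det := by
  have := isProbabilityMeasure_pathMeasure hA hweight hZ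
  -- Both sides are continuous in `t` when `f` is replaced by `t f`, and `t f` avoids the value `1`
  -- for all `t ≠ 1` close to `1`.
  have hL : Filter.Tendsto (fun t : ℂ =>
      ∫ x, ∏ p ∈ f.support, (1 - t * f p) ^ holes x p ∂(pathMeasure L R M d φ))
      (nhdsWithin 1 {1}ᶜ)
      (nhds (∫ x, ∏ p ∈ f.support, (1 - f p) ^ holes x p ∂(pathMeasure L R M d φ))) := by
    refine MeasureTheory.tendsto_integral_filter_of_dominated_convergence
      (fun _ => ∏ p ∈ f.support, (1 + 2 * ‖f p‖) ^ 1)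
      (Filter.Eventually.of_forall fun t => Measurable.of_discrete.aestronglyMeasurable) ?_
      (MeasureTheory.integrable_const _) ?_
    · have h2 : ∀ᶠ t : ℂ in nhdsWithin 1 {1}ᶜ, ‖t‖ < 2 :=
        nhdsWithin_le_nhds (continuous_norm.continuousAt.eventually (gt_mem_nhds (by simp)))
      filter_upwards [h2] with t ht
      refine Filter.Eventually.of_forall fun x => ?_
      refine (norm_prod_pow_le f.support (fun p => t * f p) (holes_le x)).trans ?_
      refine Finset.prod_le_prod (fun p _ => by positivity) fun p _ => ?_
      rw [pow_one, pow_one, norm_mul]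
      gcongr
    · refine Filter.Eventually.of_forall fun x => ?_
      have hc : Continuous fun t : ℂ => ∏ p ∈ f.support, (1 - t * f p) ^ holes x p := by fun_prop
      have := (hc.tendsto 1).mono_left (nhdsWithin_le_nhds (s := {1}ᶜ))
      simpa only [one_mul] using this
  have hR : Filter.Tendsto (fun t : ℂ => (1 - Matrix.of fun p q : f.support =>
        dualPathKernel L R M d φ p.1.1 p.1.2 q.1.1 q.1.2 * (t * f q)).det)
      (nhdsWithin 1 {1}ᶜ) (nhds (1 - Matrix.of fun p q : f.support =>
        dualPathKernel L R M d φ p.1.1 p.1.2 q.1.1 q.1.2 * f q).det) := by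
    have hc : Continuous fun t : ℂ => (1 - Matrix.of fun p q : f.support =>
        dualPathKernel L R M d φ p.1.1 p.1.2 q.1.1 q.1.2 * (t * f q)).det := by
      refine Continuous.matrix_det (continuous_const.sub (continuous_matrix fun p q => ?_))
      simp only [Matrix.of_apply]
      fun_prop
    have := (hc.tendsto 1).mono_left (nhdsWithin_le_nhds (s := {1}ᶜ))
    simpa only [one_mul] using this
  refine tendsto_nhds_unique hL (hR.congr' ?_)
  have h1 : ∀ᶠ t : ℂ in nhdsWithin 1 {1}ᶜ, ∀ p ∈ f.support, t * f p ≠ 1 := by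
    rw [Filter.eventually_all_finset]
    intro p _
    by_cases hp : f p = 1
    · filter_upwards [self_mem_nhdsWithin] with t ht
      rw [hp, mul_one]
      exact ht
    · refine nhdsWithin_le_nhds (ContinuousAt.eventually_ne (by fun_prop) ?_)
      rwa [one_mul]
  have h0 : ∀ᶠ t : ℂ in nhdsWithin 1 {1}ᶜ, t ≠ 0 :=
    nhdsWithin_le_nhds (continuousAt_id.eventually_ne one_ne_zero)
  filter_upwards [h1, h0] with t ht ht0
  have hsupp : (t • f).support = f.support := by
    ext p
    simp [ht0]
  refine (integral_prod_holes_of_ne_one hA hweight hZ (t • f) (fun p => ?_) hsupp).symm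
  by_cases hp : p ∈ f.support
  · exact ht p hp
  · rw [Finsupp.smul_apply, Finsupp.notMem_support_iff.1 hp, smul_zero]
    exact zero_ne_one

theorem isDeterminantal_holes (hA : AnalyticSymbols a b L R φ ψ)
    (hweight : ∀ x : Config L R M, 0 ≤ weight d φ x) (hZ : 0 < partitionFunction L R M d φ) :
    IsDeterminantal (pathMeasure L R M d φ) holes
      (fun p q : Site L R => dualPathKernel L R M d φ p.1 p.2 q.1 q.2) := by
  intro f
  refine ⟨integrable_of_bounded hA hweight hZ fun x => norm_prod_pow_le f.support f (holes_le x), ?_⟩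
  rw [integral_prod_holes hA hweight hZ f]
  exact hasSum_fredholm (fun p q : Site L R => dualPathKernel L R M d φ p.1 p.2 q.1 q.2) f

end Determinantal

end ToeplitzPaths

end

theorem mainTheorem1 (L R : ℤ) (hLR : L < R) (M : ℕ) (hM : 1 ≤ M) (d : ℤ)
    (φ φp φm : ℤ → ℂ → ℂ) (ε : ℝ) (hε : 0 < ε)
    (hWH : ∀ r : ℤ, L ≤ r → r < R → ToeplitzPaths.WienerHopf ε (φ r) (φp r) (φm r))
    (hweight : ∀ x : ToeplitzPaths.Config L R M, 0 ≤ ToeplitzPaths.weight d φ x)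
    (hZ : 0 < ToeplitzPaths.partitionFunction L R M d φ)
    (ρ₁ ρ₂ ρ₃ σ₁ σ₂ : ℝ) (hρ₃_pos : 0 < ρ₃) (hρ₃ : 1 - ε < ρ₃) (hρ₃₁ : ρ₃ < ρ₁)
    (hρσ₁ : ρ₁ < σ₁) (hσ : σ₁ < σ₂) (hσρ₂ : σ₂ < ρ₂) (hρ₂ : ρ₂ < 1 + ε) :
    -- the process and its dual are determinantal, with the kernels built from `T_M(φ_{L,R})⁻¹`
    MeasureTheory.IsProbabilityMeasure (ToeplitzPaths.pathMeasure L R M d φ) ∧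
    ToeplitzPaths.IsDeterminantal (ToeplitzPaths.pathMeasure L R M d φ)
      ToeplitzPaths.particles
      (fun p q : ToeplitzPaths.Site L R => ToeplitzPaths.pathKernel L R M d φ p.1 p.2 q.1 q.2) ∧
    ToeplitzPaths.IsDeterminantal (ToeplitzPaths.pathMeasure L R M d φ)
      ToeplitzPaths.holes
      (fun p q : ToeplitzPaths.Site L R =>
        ToeplitzPaths.dualPathKernel L R M d φ p.1 p.2 q.1 q.2) ∧
    -- the formulas for the two kernels
    ∃ T : ToeplitzPaths.TailSpace M →L[ℂ] ToeplitzPaths.TailSpace M,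
      ToeplitzPaths.HasMatrix T (ToeplitzPaths.kernelZero L R φp φm σ₁ σ₂) ∧
      IsUnit (1 - T) ∧
      ∀ r u s v : ℤ, L < r → r < R → L < s → s < R →
        ∃ (a : ToeplitzPaths.TailSpace M) (correction : ℂ),
          (∀ k : Set.Ici M, a k = ToeplitzPaths.aCoeff L R d φp φm ρ₂ σ₂ s v k) ∧
          HasSum (fun k : Set.Ici M =>
            (Ring.inverse (1 - T) a) k * ToeplitzPaths.bCoeff L R d φp φm ρ₁ σ₁ r u k)
            correction ∧
          ToeplitzPaths.pathKernel L R M d φ r u s v =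
            - (if r < s then (2 * Real.pi * Complex.I)⁻¹ *
                ∮ z in C(0, 1), z ^ (u - v) * ToeplitzPaths.chain φ r s z / z else 0)
            + ToeplitzPaths.mainKernel L R d φp φm ρ₁ ρ₂ r u s v
            + correction ∧
          ToeplitzPaths.dualPathKernel L R M d φ r u s v =
            - (if s < r then (2 * Real.pi * Complex.I)⁻¹ *
                ∮ z in C(0, 1), z ^ (u - v) / ToeplitzPaths.chain φ s r z / z else 0)
            + ToeplitzPaths.mainKernelStar L R d φp φm ρ₁ ρ₃ r u s v
            - correction := by
  have hfac : ∀ q, L ≤ q → q < R → ToeplitzPaths.Factorization (max 0 (1 - ε)) (1 + ε) (φ q)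
      (φp q) (φm q) := fun q h1 h2 => (hWH q h1 h2).factorization
  have hA : ToeplitzPaths.AnalyticSymbols (max 0 (1 - ε)) (1 + ε) L R φ
      (fun q z => φp q z * φm q z) :=
    { nonneg := le_max_left _ _
      lt_one := max_lt zero_lt_one (by linarith)
      one_lt := by linarith
      lt := hLR
      differentiableOn := fun q h1 h2 => (hfac q h1 h2).annulus
      eq_on_circle := fun q h1 h2 => (hfac q h1 h2).factor }
  have hdet : IsUnit (ToeplitzPaths.toeplitz M (ToeplitzPaths.chain φ L R)).det :=
    ToeplitzPaths.isUnit_det_toeplitz hA hZ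
  have hchain := ToeplitzPaths.Factorization.chain hfac
  have h3 : max 0 (1 - ε) < ρ₃ := max_lt hρ₃_pos hρ₃
  refine ⟨ToeplitzPaths.isProbabilityMeasure_pathMeasure hA hweight hZ,
    ToeplitzPaths.isDeterminantal_particles hA hweight hZ,
    ToeplitzPaths.isDeterminantal_holes hA hweight hZ,
    1 - ToeplitzPaths.compression M (ToeplitzPaths.chain φp L R) (ToeplitzPaths.chain φm L R),
    ToeplitzPaths.hasMatrix_one_sub_compression hA.nonneg hA.lt_one hA.one_lt hchain
      (h3.trans (hρ₃₁.trans hρσ₁)) hσ (hσρ₂.trans hρ₂) M, ?_, fun r u s v h1 h2 h1' h2' => ?_⟩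
  · rw [sub_sub_cancel]
    exact (ToeplitzPaths.borodin_okounkov hA.nonneg hA.lt_one hA.one_lt hchain hdet).1
  · obtain ⟨x, c, hx, hc, hK, hK'⟩ := ToeplitzPaths.exists_correction (d := d) hA.nonneg hA.lt_one
      hA.one_lt hfac hdet h3 hρ₃₁ hρσ₁ hσ hσρ₂ hρ₂ h1.le h2.le h1'.le h2'.le u v
    refine ⟨x, c, hx, ?_, ?_, ?_⟩
    · rwa [sub_sub_cancel]
    · rw [hK, ToeplitzPaths.transition]
      simp only [ToeplitzPaths.fourier, neg_sub]
    · rw [hK']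
      simp only [ToeplitzPaths.fourier, neg_zero, zpow_zero, one_mul]
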